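/- Let $X_1,X_2,\dots$ be i.i.d. real-valued random variables with continuous (atomless) distribution, and assume that $X_1\in L^{0+}$, that is, $E[|X_1|^s]<\infty$ for some $s>0$. Let $\mathbb H=\{z\in\mathbb C:\operatorname{Im} z>0\}$, $\overline{\mathbb H}=\{z:\operatorname{Im} z\ge 0\}$. For $p\in[-1,0)$ and $\alpha\in\overline{\mathbb H}$ let $f(z)=(z+\alpha)^p$ for $z\in\overline{\mathbb H}\setminus\{-\alpha\}$, where $w^p=\exp(p\log w)$ with the principal branch $\operatorname{Im}\log w\in(-\pi,\pi]$; let $f^{-1}$ be the inverse of the injective map $f$ on $\overline{\mathbb H}\setminus\{-\alpha\}$ and $f'$ its complex derivative relative to that set. Let $$M_n^f=f^{-1}\Big(\frac1n\sum_{j=1}^n f(X_j)\Big),$$ and for a complex-valued random variable $Y$ let $\operatorname{Var}(Y)=E\big[|Y-E[Y]|^2\big]$. (i) Assume that either (a) $p\in[-1,0)$ and $\alpha\in\mathbb H$, or (b) $p\in(-1,0)$, $\alpha\in\mathbb R$ and $f(X_1)\in L^2$. Then $f(X_1)\in L^2$, $M_n^f\in L^2$ for all sufficiently large $n$, and $$\lim_{n\to\infty}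 n\operatorname{Var}(M_n^f)=\frac{\operatorname{Var}(f(X_1))}{\big|f'\big(f^{-1}(E[f(X_1)])\big)\big|^2}.$$ (ii) If $p\in(-1,0)$, $\alpha\in\mathbb R$, $f(X_1)\in L^1$ and $f(X_1)\notin L^2$, then $M_n^f\in L^2$ for all sufficiently large $n$, and $$\lim_{n\to\infty} n\operatorname{Var}(M_n^f)=+\infty.$$ -/

import Mathlib

open MeasureTheory ProbabilityTheory Filter Topology

noncomputable section

namespace PowerMean

/-- The domain `ℍ̄ \ {-α}`: the closed upper half-plane without the point `-α`
(which lies in it only if `α` is real, or in the lower half-plane). -/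
def domain (α : ℂ) : Set ℂ := {z | 0 ≤ z.im ∧ z ≠ -α}

/-- The generator `f(z) = (z + α) ^ p` of the power mean, with the principal branch
`arg ∈ (-π, π]` of the power. -/
def generator (p : ℝ) (α : ℂ) (z : ℂ) : ℂ := (z + α) ^ (p : ℂ)

/-- The quasi-arithmetic mean `M_n^f = f⁻¹ ((1/n) ∑ f(X_j))` of the first `n` terms `X 0, …, X (n-1)`
of a sequence of real random variables, where `f⁻¹` is the inverse of `f` on `S`. -/
def quasiMean {Ω : Type*} (f : ℂ → ℂ) (S : Set ℂ) (X : ℕ → Ω → ℝ) (n : ℕ) (ω : Ω) : ℂ :=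
  Function.invFunOn f S ((n : ℂ)⁻¹ * ∑ j ∈ Finset.range n, f (X j ω))

/-- The variance `E[|Y - E[Y]|²]` of a complex-valued random variable
(meaningful when `Y` is square-integrable). -/
def complexVar {Ω : Type*} [MeasurableSpace Ω] (Y : Ω → ℂ) (P : Measure Ω) : ℝ :=
  ∫ ω, ‖Y ω - ∫ ω', Y ω' ∂P‖ ^ 2 ∂P

/-- `Y ∈ L^{r+}`: `Y` is in `L^s` for some real `s > r`. -/
def MemLpPlus {Ω : Type*} [MeasurableSpace Ω] (Y : Ω → ℝ) (r : ℝ) (P : Measure Ω) : Prop :=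
  ∃ s : ℝ, r < s ∧ MemLp Y (ENNReal.ofReal s) P

/-- The asymptotic variance `Var(f(X)) / |f'(f⁻¹(E[f(X)]))|²`, with `f⁻¹` the inverse of `f` on `S`
and `f'` the complex derivative of `f` relative to `S`. (At a real point of `S`, this is the derivative
of the holomorphic extension of `f|_S` across the real axis; the two-sided derivative
of the principal branch does not exist on its cut.) -/
def asymptoticVar {Ω : Type*} [MeasurableSpace Ω] (f : ℂ → ℂ) (S : Set ℂ) (X : Ω → ℝ)
    (P : Measure Ω) : ℝ :=
  complexVar (fun ω => f (X ω)) P /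
    ‖derivWithin f S (Function.invFunOn f S (∫ ω, f (X ω) ∂P))‖ ^ 2

end PowerMean

end

namespace PowerMean

/-! Put `Z_j = f(X_j)`, `W_n` the sample mean of the `Z_j`, `w = E[Z_0]` and `g(w) = w^(1/p)`.
Almost surely `M_n = g(W_n) - α`, so the claim is a delta method for the variance of `g(W_n)`. The
difficulty is that `g` has a pole-like singularity at `0`, so almost sure expansion at `w` must be
complemented by moment control.

The control comes from a half-plane. The values of `f` on the line lie almost surely in `{L > 0}`,
where `L` is the real part after rotation by `-pπ/2`; there `g` is holomorphic and `g`, `g'` are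
bounded by negative powers of `L`. By AM-GM, `L(W_n)^(-βn)` is at most the product of the
`L(Z_j)^(-β)`, and the assumption `X_1 ∈ L^{0+}` makes `A = E[L(Z_0)^(-β)]` finite for some `β > 0`.
Hence every negative moment of `L(W_n)` is finite for large `n`, and the event `L(W_n) < δ`
contributes `O((δ^β A)^n)`, negligible for small `δ` even after multiplication by `n`.

If `Z_0 ∈ L²`, the remainder of the first-order expansion is `o(1/n)` in mean square:
differentiability handles `W_n` near `w`, a Lipschitz bound and the uniform integrability of `n|W_n
- w|²` handle the rest of `{L ≥ δ}`, and the geometric bound handles `{L < δ}`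
(`tendsto_nat_mul_integral_remainder`).

If `Z_0` is only in `L¹`, then `n Cov` of `g(W_n)` with a bounded function of one variable still
converges (`tendsto_nat_mul_integral_mul`). Projecting `g(W_n)` on means of truncations of the `Z_j`
bounds `n Var` below by truncated second moments, which are unbounded.

Finally, averages of values of `f` must lie in the range of `f`, so that `f⁻¹` is given by `g - α`
there. This is a convexity statement: sector inequalities for the argument and supporting
half-planes for the image of `{Im ≥ Im α}` (`generatorInv_integral`). -/

theorem integral_pos_of_ae_pos {Ω : Type*} [MeasurableSpace Ω] {ν : Measure Ω}
    [IsProbabilityMeasure ν] {f : Ω → ℝ} (hf : Integrable f ν) (h : ∀ᵐ ω ∂ν, 0 < f ω) :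
    0 < ∫ ω, f ω ∂ν := by
  rw [integral_pos_iff_support_of_nonneg_ae (h.mono fun ω hω => hω.le) hf]
  have : (Function.support f) =ᵐ[ν] Set.univ := by
    filter_upwards [h] with ω hω
    exact propext ⟨fun _ => trivial, fun _ => hω.ne'⟩
  rw [measure_congr this]; simp

/-! ### Negative moments of means of positive i.i.d. variables -/

section Sequences

variable {Ω : Type*} [MeasurableSpace Ω] {P : Measure Ω}

/-- Exchangeability; it is applied with a transposition against the identity. -/
theorem identDistrib_precomp_injective {ι E : Type*} [Countable ι] [MeasurableSpace E]
    {Z : ℕ → Ω → E} (hind : iIndepFun Z P) (hid : ∀ j, IdentDistrib (Z j) (Z 0) P P)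
    {σ τ : ι → ℕ} (hσ : σ.Injective) (hτ : τ.Injective) :
    IdentDistrib (fun ω i => Z (σ i) ω) (fun ω i => Z (τ i) ω) P P :=
  IdentDistrib.pi (fun i => (hid (σ i)).trans (hid (τ i)).symm)
    (hind.precomp hσ) (hind.precomp hτ)

/-- AM-GM raised to the negative power `-(β n)`. The right side factorises under independence, which
is why the exponent grows with `n`. -/
theorem rpow_mean_le_prod_rpow {n : ℕ} (hn : 0 < n) {y : ℕ → ℝ} (hy : ∀ j, 0 < y j)
    {β : ℝ} (hβ : 0 < β) :
    ((n : ℝ)⁻¹ * ∑ j ∈ Finset.range n, y j) ^ (-(β * n)) ≤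
      ∏ j ∈ Finset.range n, y j ^ (-β) := by
  have hn' : (0 : ℝ) < n := by exact_mod_cast hn
  have h1 := Real.geom_mean_le_arith_mean_weighted (Finset.range n) (fun _ => (n : ℝ)⁻¹) y
    (fun _ _ => by positivity) (by simp [hn'.ne']) (fun j _ => (hy j).le)
  rw [← Finset.mul_sum] at h1
  have h0 : 0 < ∏ j ∈ Finset.range n, y j ^ ((n : ℝ)⁻¹) :=
    Finset.prod_pos fun j _ => Real.rpow_pos_of_pos (hy j) _
  refine (Real.rpow_le_rpow_of_nonpos h0 h1 (by have := mul_pos hβ hn'; linarith)).trans_eq ?_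
  rw [← Real.finsetProd_rpow _ _ fun j _ => (Real.rpow_pos_of_pos (hy j) _).le]
  refine Finset.prod_congr rfl fun j _ => ?_
  rw [← Real.rpow_mul (hy j).le]
  congr 1
  field_simp

theorem ae_forall_of_identDistrib {E : Type*} [MeasurableSpace E] {Z : ℕ → Ω → E}
    (hid : ∀ j, IdentDistrib (Z j) (Z 0) P P) {p : E → Prop} (hp : MeasurableSet {x | p x})
    (h : ∀ᵐ ω ∂P, p (Z 0 ω)) : ∀ᵐ ω ∂P, ∀ j, p (Z j ω) :=
  ae_all_iff.2 fun j => (hid j).symm.ae_snd hp h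

variable [IsProbabilityMeasure P] {Y : ℕ → Ω → ℝ} {β : ℝ}

theorem integrable_mean_rpow_neg_mul (hY : ∀ j, Measurable (Y j)) (hind : iIndepFun Y P)
    (hid : ∀ j, IdentDistrib (Y j) (Y 0) P P) (hpos : ∀ᵐ ω ∂P, 0 < Y 0 ω) (hβ : 0 < β)
    (hint : Integrable (fun ω => Y 0 ω ^ (-β)) P) {n : ℕ} (hn : 0 < n) :
    Integrable (fun ω => ((n : ℝ)⁻¹ * ∑ j ∈ Finset.range n, Y j ω) ^ (-(β * n))) P ∧
    ∫ ω, ((n : ℝ)⁻¹ * ∑ j ∈ Finset.range n, Y j ω) ^ (-(β * n)) ∂P ≤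
      (∫ ω, Y 0 ω ^ (-β) ∂P) ^ n := by
  have hpos' : ∀ᵐ ω ∂P, ∀ j, 0 < Y j ω := ae_forall_of_identDistrib hid measurableSet_Ioi hpos
  have hmeas : ∀ j, Measurable fun ω => Y j ω ^ (-β) := fun j => (hY j).pow_const _
  have hpw : iIndepFun (fun j ω => Y j ω ^ (-β)) P :=
    hind.comp (fun _ x => x ^ (-β)) fun _ => by fun_prop
  have hidp : ∀ j, IdentDistrib (fun ω => Y j ω ^ (-β)) (fun ω => Y 0 ω ^ (-β)) P P :=
    fun j => (hid j).comp (u := fun x => x ^ (-β)) (by fun_prop)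
  have hprodint : ∫ ω, ∏ j : Fin n, Y j ω ^ (-β) ∂P = (∫ ω, Y 0 ω ^ (-β) ∂P) ^ n := by
    have := (hpw.precomp Fin.val_injective (g := fun j : Fin n => (j : ℕ))).integral_fun_prod_eq_prod_integral
      (fun i => (hmeas i).aestronglyMeasurable)
    rw [this]
    simp [(hidp _).integral_eq]
  -- A non-integrable function has integral `0` by convention, whereas this integral is a power of a
  -- positive number.
  have hprodI : Integrable (fun ω => ∏ j : Fin n, Y j ω ^ (-β)) P := by
    by_contra h
    have h1 := integral_undef h
    rw [hprodint] at h1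
    have h2 : 0 < ∫ ω, Y 0 ω ^ (-β) ∂P := 
      integral_pos_of_ae_pos hint (hpos.mono fun ω hω => Real.rpow_pos_of_pos hω _)
    exact (pow_pos h2 n).ne' h1
  have hle : ∀ᵐ ω ∂P, ((n : ℝ)⁻¹ * ∑ j ∈ Finset.range n, Y j ω) ^ (-(β * n)) ≤
      ∏ j : Fin n, Y j ω ^ (-β) := by
    filter_upwards [hpos'] with ω hω
    rw [← Finset.prod_range fun j => Y j ω ^ (-β)]
    exact rpow_mean_le_prod_rpow hn hω hβ
  have hnn : ∀ᵐ ω ∂P, 0 ≤ ((n : ℝ)⁻¹ * ∑ j ∈ Finset.range n, Y j ω) ^ (-(β * n)) := by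
    filter_upwards [hpos'] with ω hω
    exact Real.rpow_nonneg (mul_nonneg (by positivity) (Finset.sum_nonneg fun j _ => (hω j).le)) _
  have hI : Integrable (fun ω => ((n : ℝ)⁻¹ * ∑ j ∈ Finset.range n, Y j ω) ^ (-(β * n))) P := by
    refine hprodI.mono' (Measurable.aestronglyMeasurable (by fun_prop)) ?_
    filter_upwards [hle, hnn] with ω h1 h2
    rwa [Real.norm_of_nonneg h2]
  exact ⟨hI, (integral_mono_ae hI hprodI hle).trans_eq hprodint⟩

/-- Negative moments of the mean of `n` positive i.i.d. variables are finite for large `n`, and the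
contribution of the event that the mean is small decays geometrically. -/
theorem integrable_mean_rpow_neg (hY : ∀ j, Measurable (Y j)) (hind : iIndepFun Y P)
    (hid : ∀ j, IdentDistrib (Y j) (Y 0) P P) (hpos : ∀ᵐ ω ∂P, 0 < Y 0 ω) (hβ : 0 < β)
    (hint : Integrable (fun ω => Y 0 ω ^ (-β)) P) {n : ℕ} (hn : 0 < n) {t : ℝ} (ht : 0 ≤ t)
    (htn : t ≤ β * n) {δ : ℝ} (hδ : 0 < δ) :
    Integrable (fun ω => ((n : ℝ)⁻¹ * ∑ j ∈ Finset.range n, Y j ω) ^ (-t)) P ∧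
    ∫ ω in {ω | (n : ℝ)⁻¹ * ∑ j ∈ Finset.range n, Y j ω < δ},
      ((n : ℝ)⁻¹ * ∑ j ∈ Finset.range n, Y j ω) ^ (-t) ∂P ≤
      δ ^ (-t) * (δ ^ β * ∫ ω, Y 0 ω ^ (-β) ∂P) ^ n := by
  obtain ⟨hI, hle⟩ := integrable_mean_rpow_neg_mul hY hind hid hpos hβ hint hn
  have hpos' : ∀ᵐ ω ∂P, 0 < (n : ℝ)⁻¹ * ∑ j ∈ Finset.range n, Y j ω := by
    filter_upwards [ae_forall_of_identDistrib hid measurableSet_Ioi hpos] with ω hω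
    have hn' : (0 : ℝ) < n := by exact_mod_cast hn
    exact mul_pos (by positivity) (Finset.sum_pos (fun j _ => hω j) (by simpa using hn.ne'))
  -- Since `β n - t ≥ 0`, the surplus power of `x` is at most that of `δ`; this trades the order `t`
  -- for the order `β n` controlled by AM-GM.
  have key : ∀ x : ℝ, 0 < x → x < δ → x ^ (-t) ≤ δ ^ (β * n - t) * x ^ (-(β * n)) := by
    intro x hx hxδ
    have : x ^ (-t) = x ^ (β * n - t) * x ^ (-(β * n)) := by
      rw [← Real.rpow_add hx]; ring_nf
    rw [this]
    gcongr
  have hm : Measurable fun ω => (n : ℝ)⁻¹ * ∑ j ∈ Finset.range n, Y j ω := by fun_prop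
  have hint' : Integrable (fun ω => ((n : ℝ)⁻¹ * ∑ j ∈ Finset.range n, Y j ω) ^ (-t)) P := by
    refine ((integrable_const (δ ^ (-t))).add (hI.const_mul (δ ^ (β * n - t)))).mono'
      (Measurable.aestronglyMeasurable (by fun_prop)) ?_
    filter_upwards [hpos'] with ω hω
    rw [Real.norm_of_nonneg (Real.rpow_nonneg hω.le _)]
    simp only [Pi.add_apply]
    have p1 : 0 ≤ δ ^ (-t) := by positivity
    have p2 := Real.rpow_nonneg hω.le (-(β * n))
    have p3 : 0 ≤ δ ^ (β * n - t) := by positivity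
    rcases lt_or_ge ((n : ℝ)⁻¹ * ∑ j ∈ Finset.range n, Y j ω) δ with h | h
    · have := key _ hω h; linarith
    · have := Real.rpow_le_rpow_of_nonpos hδ h (neg_nonpos.2 ht)
      have := mul_nonneg p3 p2
      linarith
  refine ⟨hint', ?_⟩
  calc _ ≤ ∫ ω in {ω | (n : ℝ)⁻¹ * ∑ j ∈ Finset.range n, Y j ω < δ},
        δ ^ (β * n - t) * ((n : ℝ)⁻¹ * ∑ j ∈ Finset.range n, Y j ω) ^ (-(β * n)) ∂P := by
        refine setIntegral_mono_on_ae hint'.integrableOn (hI.const_mul _).integrableOn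
          (measurableSet_lt hm measurable_const) ?_
        filter_upwards [hpos'] with ω hω h using key _ hω h
    _ ≤ ∫ ω, δ ^ (β * n - t) * ((n : ℝ)⁻¹ * ∑ j ∈ Finset.range n, Y j ω) ^ (-(β * n)) ∂P := by
        refine setIntegral_le_integral (hI.const_mul _) ?_
        filter_upwards [hpos'] with ω hω
        have := Real.rpow_nonneg hω.le (-(β * n))
        simp only [Pi.zero_apply]; positivity
    _ ≤ δ ^ (β * n - t) * (∫ ω, Y 0 ω ^ (-β) ∂P) ^ n := by
        rw [integral_const_mul]; gcongr
    _ = _ := by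
        rw [mul_pow, ← Real.rpow_mul_natCast hδ.le, ← mul_assoc, ← Real.rpow_add hδ]
        ring_nf

/-- Choice of the threshold that makes the geometric ratio less than one; it does not depend on the
order of the moment. -/
theorem exists_pos_rpow_mul_lt_one (hβ : 0 < β) (A : ℝ) {ε : ℝ} (hε : 0 < ε) :
    ∃ δ, 0 < δ ∧ δ < ε ∧ |δ ^ β * A| < 1 := by
  have : Tendsto (fun δ : ℝ => |δ ^ β * A|) (𝓝[>] 0) (𝓝 0) := by
    have h := ((Real.continuousAt_rpow_const 0 β (Or.inr hβ.le)).tendsto.mul_const A).abs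
    simp only [Real.zero_rpow hβ.ne', zero_mul, abs_zero] at h
    exact h.mono_left nhdsWithin_le_nhds
  obtain ⟨δ, h1, h2, h3⟩ := ((this.eventually_lt_const one_pos).and
    ((eventually_mem_nhdsWithin (a := (0 : ℝ)) (s := Set.Ioi 0)).and
      (eventually_nhdsWithin_of_eventually_nhds (eventually_lt_nhds hε)))).exists
  exact ⟨δ, h2, h3, h1⟩

theorem tendsto_nat_mul_mean_rpow_neg (hY : ∀ j, Measurable (Y j)) (hind : iIndepFun Y P)
    (hid : ∀ j, IdentDistrib (Y j) (Y 0) P P) (hpos : ∀ᵐ ω ∂P, 0 < Y 0 ω) (hβ : 0 < β)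
    (hint : Integrable (fun ω => Y 0 ω ^ (-β)) P) {t : ℝ} (ht : 0 ≤ t) {δ : ℝ} (hδ : 0 < δ)
    (hδA : |δ ^ β * ∫ ω, Y 0 ω ^ (-β) ∂P| < 1) :
    Tendsto (fun n : ℕ => (n : ℝ) * ∫ ω in {ω | (n : ℝ)⁻¹ * ∑ j ∈ Finset.range n, Y j ω < δ},
      ((n : ℝ)⁻¹ * ∑ j ∈ Finset.range n, Y j ω) ^ (-t) ∂P) atTop (𝓝 0) := by
  have hlim := (tendsto_self_mul_const_pow_of_abs_lt_one hδA).const_mul (δ ^ (-t))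
  rw [mul_zero] at hlim
  refine squeeze_zero' ?_ ?_ hlim
  · refine .of_forall fun n => mul_nonneg n.cast_nonneg (integral_nonneg_of_ae (ae_restrict_of_ae ?_))
    filter_upwards [ae_forall_of_identDistrib hid measurableSet_Ioi hpos] with ω hω
    exact Real.rpow_nonneg (mul_nonneg (by positivity) (Finset.sum_nonneg fun j _ => (hω j).le)) _
  · have hb : Tendsto (fun n : ℕ => β * n) atTop atTop :=
      tendsto_natCast_atTop_atTop.const_mul_atTop hβ
    filter_upwards [eventually_gt_atTop 0, hb.eventually_ge_atTop t] with n hn htn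
    have := (integrable_mean_rpow_neg hY hind hid hpos hβ hint hn ht htn hδ).2
    calc _ ≤ (n : ℝ) * (δ ^ (-t) * (δ ^ β * ∫ ω, Y 0 ω ^ (-β) ∂P) ^ n) := by gcongr
      _ = _ := by ring

end Sequences

end PowerMean

namespace PowerMean

/-! ### Uniform integrability of normalised squares, by a leave-one-out argument -/

section Square

variable {Ω : Type*} [MeasurableSpace Ω] {P : Measure Ω} [IsProbabilityMeasure P]

theorem abs_min_one_abs_sub_le (x y : ℝ) : abs (min 1 |x| - min 1 |y|) ≤ |x - y| := by
  have h1 := abs_min_sub_min_le_max 1 |x| 1 |y|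
  have h2 := abs_abs_sub_abs_le_abs_sub x y
  simp only [sub_self, abs_zero] at h1
  exact h1.trans (max_le (abs_nonneg _) h2)

/-- The cut-off `min 1 |·|` is 1-Lipschitz. Inside it, `x + t` is replaced by `t` in the cross term
and by `x` in the square term; each replacement costs `x² |t| / n`. -/
theorem mul_sum_mul_min_le (x t : ℝ) {n : ℝ} (hn : 0 < n) :
    x * ((x + t) * min 1 |(x + t) / n|) ≤
      x * (t * min 1 |t / n|) + (2 / n) * (x ^ 2 * |t|) + x ^ 2 * min 1 |x / n| := by
  have h1 := abs_min_one_abs_sub_le ((x + t) / n) (t / n)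
  have h2 := abs_min_one_abs_sub_le ((x + t) / n) (x / n)
  rw [← sub_div, add_sub_cancel_right, abs_div x, abs_of_pos hn] at h1
  rw [← sub_div, add_sub_cancel_left, abs_div t, abs_of_pos hn] at h2
  set a := min 1 |(x + t) / n|
  set b := min 1 |t / n|
  set c := min 1 |x / n|
  have h3 : x * t * (a - b) ≤ (1 / n) * (x ^ 2 * |t|) := by
    calc x * t * (a - b) ≤ |x * t * (a - b)| := le_abs_self _
      _ = |x| * |t| * |a - b| := by rw [abs_mul, abs_mul]
      _ ≤ |x| * |t| * (|x| / n) := by gcongr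
      _ = (1 / n) * (|x| ^ 2 * |t|) := by ring
      _ = _ := by rw [sq_abs]
  have h4 : x ^ 2 * (a - c) ≤ (1 / n) * (x ^ 2 * |t|) := by
    calc x ^ 2 * (a - c) ≤ x ^ 2 * (|t| / n) := by
          gcongr; exact (le_abs_self _).trans h2
      _ = _ := by ring
  have : (2 / n) * (x ^ 2 * |t|) = (1 / n) * (x ^ 2 * |t|) + (1 / n) * (x ^ 2 * |t|) := by ring
  rw [this]
  nlinarith

variable {ξ : ℕ → Ω → ℝ}

theorem integral_sum_sq (hid : ∀ j, IdentDistrib (ξ j) (ξ 0) P P) (hind : iIndepFun ξ P)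
    (hL : MemLp (ξ 0) 2 P) (h0 : ∫ ω, ξ 0 ω ∂P = 0) (s : Finset ℕ) :
    ∫ ω, (∑ j ∈ s, ξ j ω) ^ 2 ∂P = s.card * ∫ ω, ξ 0 ω ^ 2 ∂P := by
  have hL' : ∀ j, MemLp (ξ j) 2 P := fun j => (hid j).symm.memLp_snd hL
  have h0' : ∀ j, ∫ ω, ξ j ω ∂P = 0 := fun j => (hid j).integral_eq.trans h0
  have hv := IndepFun.variance_sum (X := ξ) (s := s) (fun j _ => hL' j)
    (fun i _ j _ hij => hind.indepFun hij)
  rw [variance_of_integral_eq_zero, Finset.sum_congr rfl fun j _ => (hid j).variance_eq,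
    variance_of_integral_eq_zero hL.aestronglyMeasurable.aemeasurable h0] at hv
  · simpa using hv
  · exact (memLp_finsetSum' s fun j _ => hL' j).aestronglyMeasurable.aemeasurable
  · simp only [Finset.sum_apply]
    rw [integral_finsetSum _ fun j _ => (hL' j).integrable one_le_two]
    simp [h0']

/-- Write one factor of `S²` as `∑ ξ_j` and, in each term, split `S = ξ_j + T` with `T` independent
of `ξ_j`. The main term `ξ_j T min(1, |T/n|)` has mean zero, and `E|T| = O(√n)` controls the error.
-/
theorem integral_sum_sq_mul_min_le (hξ : ∀ j, Measurable (ξ j))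
    (hid : ∀ j, IdentDistrib (ξ j) (ξ 0) P P) (hind : iIndepFun ξ P)
    (hL : MemLp (ξ 0) 2 P) (h0 : ∫ ω, ξ 0 ω ∂P = 0) {n : ℕ} (hn : 0 < n) :
    ∫ ω, (∑ j ∈ Finset.range n, ξ j ω) ^ 2 * min 1 |(∑ j ∈ Finset.range n, ξ j ω) / n| ∂P ≤
      n * ((∫ ω, ξ 0 ω ^ 2 ∂P) * (1 + ∫ ω, ξ 0 ω ^ 2 ∂P) / √n +
        ∫ ω, ξ 0 ω ^ 2 * min 1 |ξ 0 ω / n| ∂P) := by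
  have hn' : (0 : ℝ) < n := by exact_mod_cast hn
  have hL' : ∀ j, MemLp (ξ j) 2 P := fun j => (hid j).symm.memLp_snd hL
  have h0' : ∀ j, ∫ ω, ξ j ω ∂P = 0 := fun j => (hid j).integral_eq.trans h0
  set σ2 := ∫ ω, ξ 0 ω ^ 2 ∂P with hσ2
  have hσ0 : 0 ≤ σ2 := integral_nonneg fun _ => sq_nonneg _
  set S : Ω → ℝ := fun ω => ∑ j ∈ Finset.range n, ξ j ω with hS
  have hSm : Measurable S := by fun_prop
  have hSL : MemLp S 2 P := memLp_finsetSum _ fun j _ => hL' j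
  have hφ : ∀ x : ℝ, ‖min 1 |x|‖ ≤ 1 := fun x => by
    rw [Real.norm_of_nonneg (le_min zero_le_one (abs_nonneg x))]; exact min_le_left _ _
  have hbd : ∀ {T : Ω → ℝ}, Measurable T → MemLp T 2 P →
      MemLp (fun ω => T ω * min 1 |T ω / n|) 2 P := fun {T} hTm hTL =>
    hTL.of_le (Measurable.aestronglyMeasurable (by fun_prop)) (.of_forall fun ω => by
      rw [norm_mul]; exact mul_le_of_le_one_right (norm_nonneg _) (hφ _))
  have hterm : ∀ j ∈ Finset.range n, ∫ ω, ξ j ω * (S ω * min 1 |S ω / n|) ∂P ≤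
      σ2 * (1 + σ2) / √n + ∫ ω, ξ 0 ω ^ 2 * min 1 |ξ 0 ω / n| ∂P := by
    intro j hj
    set T : Ω → ℝ := fun ω => ∑ i ∈ (Finset.range n).erase j, ξ i ω with hT
    have hTm : Measurable T := by fun_prop
    have hTL : MemLp T 2 P := memLp_finsetSum _ fun j _ => hL' j
    have hST : ∀ ω, S ω = ξ j ω + T ω := fun ω =>
      (Finset.add_sum_erase _ (fun i => ξ i ω) hj).symm
    have hindT : IndepFun (ξ j) T P := by
      have := (hind.indepFun_finsetSum_of_notMem hξ
        (Finset.notMem_erase j (Finset.range n))).symm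
      convert this using 1
      ext ω; simp [hT]
    have i1 : Integrable (fun ω => ξ j ω * (T ω * min 1 |T ω / n|)) P :=
      (hL' j).integrable_mul (hbd hTm hTL)
    have i2 : Integrable (fun ω => ξ j ω ^ 2 * |T ω|) P :=
      (hindT.comp (φ := fun x => x ^ 2) (ψ := fun x => |x|) (by fun_prop)
        (by fun_prop)).integrable_mul (hL' j).integrable_sq (hTL.integrable one_le_two).abs
    have i3 : Integrable (fun ω => ξ j ω ^ 2 * min 1 |ξ j ω / n|) P :=
      (hL' j).integrable_sq.mul_bdd (c := 1) (Measurable.aestronglyMeasurable (by fun_prop))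
        (.of_forall fun _ => hφ _)
    have i0 : Integrable (fun ω => ξ j ω * (S ω * min 1 |S ω / n|)) P :=
      (hL' j).integrable_mul (hbd hSm hSL)
    have e1 : ∫ ω, ξ j ω * (T ω * min 1 |T ω / n|) ∂P = 0 := by
      rw [hindT.integral_fun_comp_mul_comp (f := fun x : ℝ => x) (g := fun x : ℝ => x * min 1 |x / n|)
        (hξ j).aemeasurable hTm.aemeasurable (Measurable.aestronglyMeasurable (by fun_prop))
        (Measurable.aestronglyMeasurable (by fun_prop)), h0' j, zero_mul]
    have e2 : ∫ ω, ξ j ω ^ 2 * |T ω| ∂P = σ2 * ∫ ω, |T ω| ∂P := by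
      rw [hindT.integral_fun_comp_mul_comp (f := fun x : ℝ => x ^ 2) (g := fun x : ℝ => |x|)
        (hξ j).aemeasurable hTm.aemeasurable (Measurable.aestronglyMeasurable (by fun_prop))
        (Measurable.aestronglyMeasurable (by fun_prop)), (hid j).sq.integral_eq]
    have e3 : ∫ ω, ξ j ω ^ 2 * min 1 |ξ j ω / n| ∂P = ∫ ω, ξ 0 ω ^ 2 * min 1 |ξ 0 ω / n| ∂P :=
      ((hid j).comp (u := fun x : ℝ => x ^ 2 * min 1 |x / n|) (by fun_prop)).integral_eq
    have e4 : ∫ ω, |T ω| ∂P ≤ (1 + σ2) * √n / 2 := by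
      have hsq : ∫ ω, T ω ^ 2 ∂P ≤ n * σ2 := by
        rw [integral_sum_sq hid hind hL h0]
        gcongr
        exact (Finset.card_le_card (Finset.erase_subset _ _)).trans_eq (Finset.card_range n)
      have hs : 0 < √(n : ℝ) := Real.sqrt_pos.2 hn'
      calc ∫ ω, |T ω| ∂P ≤ ∫ ω, (T ω ^ 2 / √n + √n) / 2 ∂P := by
            refine integral_mono (hTL.integrable one_le_two).abs
              (((hTL.integrable_sq.div_const _).add (integrable_const _)).div_const _) fun ω => ?_
            have : 0 ≤ (|T ω| - √n) ^ 2 / √n := by positivity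
            have h' : (|T ω| - √n) ^ 2 / √n = T ω ^ 2 / √n - 2 * |T ω| + √n := by
              rw [sub_sq, sq_abs]; field_simp
            linarith
        _ = ((∫ ω, T ω ^ 2 ∂P) / √n + √n) / 2 := by
            rw [integral_div, integral_add (hTL.integrable_sq.div_const _) (integrable_const _),
              integral_div]
            simp
        _ ≤ (n * σ2 / √n + √n) / 2 := by gcongr
        _ = _ := by
            have : (n : ℝ) / √n = √n := Real.div_sqrt
            rw [mul_comm, mul_div_assoc, this]; ring
    calc ∫ ω, ξ j ω * (S ω * min 1 |S ω / n|) ∂P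
        ≤ ∫ ω, (ξ j ω * (T ω * min 1 |T ω / n|) + (2 / n) * (ξ j ω ^ 2 * |T ω|) +
            ξ j ω ^ 2 * min 1 |ξ j ω / n|) ∂P := by
          refine integral_mono i0 ((i1.add (i2.const_mul _)).add i3) fun ω => ?_
          simp only [hST]
          exact mul_sum_mul_min_le _ _ hn'
      _ = (2 / n) * (σ2 * ∫ ω, |T ω| ∂P) + ∫ ω, ξ 0 ω ^ 2 * min 1 |ξ 0 ω / n| ∂P := by
          have i12 : Integrable (fun ω => ξ j ω * (T ω * min 1 |T ω / n|) +
              (2 / n) * (ξ j ω ^ 2 * |T ω|)) P := i1.add (i2.const_mul _)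
          rw [integral_add i12 i3, integral_add i1 (i2.const_mul _),
            integral_const_mul, e1, e2, e3, zero_add]
      _ ≤ (2 / n) * (σ2 * ((1 + σ2) * √n / 2)) + ∫ ω, ξ 0 ω ^ 2 * min 1 |ξ 0 ω / n| ∂P := by
          gcongr
      _ = _ := by
          congr 1
          have hs : √(n : ℝ) ≠ 0 := (Real.sqrt_pos.2 hn').ne'
          have hss : (n : ℝ) = √n * √n := (Real.mul_self_sqrt hn'.le).symm
          have : √(n : ℝ) / n = 1 / √n := by rw [Real.sqrt_div_self']
          calc _ = σ2 * (1 + σ2) * (√n / n) := by ring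
            _ = _ := by rw [this]; ring
  have i0 : ∀ j ∈ Finset.range n, Integrable (fun ω => ξ j ω * (S ω * min 1 |S ω / n|)) P :=
    fun j _ => (hL' j).integrable_mul (hbd hSm hSL)
  calc _ = ∫ ω, ∑ j ∈ Finset.range n, ξ j ω * (S ω * min 1 |S ω / n|) ∂P := by
        refine integral_congr_ae (.of_forall fun ω => ?_)
        simp only [← Finset.sum_mul]
        ring
    _ = ∑ j ∈ Finset.range n, ∫ ω, ξ j ω * (S ω * min 1 |S ω / n|) ∂P :=
        integral_finsetSum _ i0
    _ ≤ ∑ j ∈ Finset.range n, (σ2 * (1 + σ2) / √n + ∫ ω, ξ 0 ω ^ 2 * min 1 |ξ 0 ω / n| ∂P) :=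
        Finset.sum_le_sum hterm
    _ = _ := by simp [mul_add]

/-- Uniform integrability of the normalised squares of centred means. -/
theorem tendsto_nat_mul_integral_mean_sq_mul_min (hξ : ∀ j, Measurable (ξ j))
    (hid : ∀ j, IdentDistrib (ξ j) (ξ 0) P P) (hind : iIndepFun ξ P)
    (hL : MemLp (ξ 0) 2 P) (h0 : ∫ ω, ξ 0 ω ∂P = 0) :
    Tendsto (fun n : ℕ => (n : ℝ) * ∫ ω, ((n : ℝ)⁻¹ * ∑ j ∈ Finset.range n, ξ j ω) ^ 2 *
      min 1 |(n : ℝ)⁻¹ * ∑ j ∈ Finset.range n, ξ j ω| ∂P) atTop (𝓝 0) := by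
  have hφ : ∀ x : ℝ, 0 ≤ min 1 |x| := fun x => le_min zero_le_one (abs_nonneg x)
  have h1 : Tendsto (fun n : ℕ => (∫ ω, ξ 0 ω ^ 2 ∂P) * (1 + ∫ ω, ξ 0 ω ^ 2 ∂P) / √(n : ℝ))
      atTop (𝓝 0) :=
    tendsto_const_nhds.div_atTop (Real.tendsto_sqrt_atTop.comp tendsto_natCast_atTop_atTop)
  have h2 : Tendsto (fun n : ℕ => ∫ ω, ξ 0 ω ^ 2 * min 1 |ξ 0 ω / n| ∂P) atTop (𝓝 0) := by
    have := tendsto_integral_of_dominated_convergence (μ := P) (f := fun _ => (0 : ℝ))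
      (F := fun (n : ℕ) ω => ξ 0 ω ^ 2 * min 1 |ξ 0 ω / n|) (fun ω => ξ 0 ω ^ 2)
      (fun n => Measurable.aestronglyMeasurable (by have := hξ 0; fun_prop)) hL.integrable_sq
      (fun n => .of_forall fun ω => ?_) (.of_forall fun ω => ?_)
    · simpa using this
    · rw [Real.norm_of_nonneg (mul_nonneg (sq_nonneg _) (hφ _))]
      exact mul_le_of_le_one_right (sq_nonneg _) (min_le_left _ _)
    · have h3 : Tendsto (fun n : ℕ => ξ 0 ω / n) atTop (𝓝 0) :=
        tendsto_const_nhds.div_atTop tendsto_natCast_atTop_atTop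
      simpa using ((tendsto_const_nhds (x := (1 : ℝ))).min h3.abs).const_mul (ξ 0 ω ^ 2)
  have h12 := h1.add h2
  rw [zero_add] at h12
  refine squeeze_zero' (.of_forall fun n => mul_nonneg n.cast_nonneg
    (integral_nonneg fun ω => mul_nonneg (sq_nonneg _) (hφ _))) ?_ h12
  filter_upwards [eventually_gt_atTop 0] with n hn
  have hn' : (0 : ℝ) < n := by exact_mod_cast hn
  have := integral_sum_sq_mul_min_le hξ hid hind hL h0 hn
  rw [← div_le_iff₀' hn'] at this
  refine le_trans (le_of_eq ?_) this
  rw [← integral_const_mul, ← integral_div]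
  refine integral_congr_ae (.of_forall fun ω => ?_)
  simp only [div_eq_inv_mul]
  field_simp

end Square

end PowerMean

noncomputable section

namespace PowerMean

/-! ### Variance of complex variables and second moments of complex sample means -/

section Variance

variable {Ω : Type*} [MeasurableSpace Ω] {P : Measure Ω}

theorem norm_add_sq_complex (a b : ℂ) :
    ‖a + b‖ ^ 2 = ‖a‖ ^ 2 + 2 * ((starRingEnd ℂ) a * b).re + ‖b‖ ^ 2 := by
  rw [← Complex.normSq_eq_norm_sq, ← Complex.normSq_eq_norm_sq, ← Complex.normSq_eq_norm_sq]
  simp only [Complex.normSq_apply, Complex.add_re, Complex.add_im, Complex.mul_re,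
    Complex.conj_re, Complex.conj_im]
  ring

theorem complexVar_congr {Y Y' : Ω → ℂ} (h : Y =ᵐ[P] Y') : complexVar Y P = complexVar Y' P := by
  unfold complexVar
  rw [integral_congr_ae h]
  refine integral_congr_ae ?_
  filter_upwards [h] with ω hω
  rw [hω]

/-- The mean of the first `n` terms of a sequence of complex random variables. -/
def sampleMean {Ω : Type*} (Z : ℕ → Ω → ℂ) (n : ℕ) (ω : Ω) : ℂ := (n : ℂ)⁻¹ * ∑ j ∈ Finset.range n, Z j ω

variable {Z : ℕ → Ω → ℂ}

theorem map_sampleMean {Ω : Type*} {Z : ℕ → Ω → ℂ} (L : ℂ →L[ℝ] ℝ) (n : ℕ) (ω : Ω) :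
    L (sampleMean Z n ω) = (n : ℝ)⁻¹ * ∑ j ∈ Finset.range n, L (Z j ω) := by
  have : sampleMean Z n ω = (n : ℝ)⁻¹ • ∑ j ∈ Finset.range n, Z j ω := by
    simp [sampleMean]
  rw [this, map_smul, map_sum, smul_eq_mul]

theorem measurable_sampleMean (hZ : ∀ j, Measurable (Z j)) (n : ℕ) :
    Measurable (sampleMean Z n) := by
  unfold sampleMean; fun_prop

theorem memLp_sampleMean {p : ENNReal} (hid : ∀ j, IdentDistrib (Z j) (Z 0) P P)
    (hL : MemLp (Z 0) p P) (n : ℕ) : MemLp (sampleMean Z n) p P :=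
  (memLp_finsetSum _ fun j _ => (hid j).symm.memLp_snd hL).const_mul _

theorem integral_sampleMean (hid : ∀ j, IdentDistrib (Z j) (Z 0) P P)
    (hL : Integrable (Z 0) P) {n : ℕ} (hn : 0 < n) :
    ∫ ω, sampleMean Z n ω ∂P = ∫ ω, Z 0 ω ∂P := by
  unfold sampleMean
  rw [integral_const_mul, integral_finsetSum _ fun j _ => (hid j).symm.integrable_snd hL,
    Finset.sum_congr rfl fun j _ => (hid j).integral_eq]
  have : (n : ℂ) ≠ 0 := by exact_mod_cast hn.ne'
  simp [this]

theorem identDistrib_map_sub (hid : ∀ j, IdentDistrib (Z j) (Z 0) P P) (L : ℂ →L[ℝ] ℝ) (c : ℝ)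
    (j : ℕ) : IdentDistrib (fun ω => L (Z j ω) - c) (fun ω => L (Z 0 ω) - c) P P :=
  (hid j).comp (u := fun z => L z - c) (by fun_prop)

theorem iIndepFun_map_sub (hind : iIndepFun Z P) (L : ℂ →L[ℝ] ℝ) (c : ℝ) :
    iIndepFun (fun j ω => L (Z j ω) - c) P :=
  hind.comp (fun _ z => L z - c) fun _ => by fun_prop

theorem map_sampleMean_sub {Ω : Type*} {Z : ℕ → Ω → ℂ} (L : ℂ →L[ℝ] ℝ) {n : ℕ} (hn : 0 < n) (w : ℂ) (ω : Ω) :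
    L (sampleMean Z n ω - w) = (n : ℝ)⁻¹ * ∑ j ∈ Finset.range n, (L (Z j ω) - L w) := by
  have : (n : ℝ) ≠ 0 := by exact_mod_cast hn.ne'
  rw [map_sub, map_sampleMean, Finset.sum_sub_distrib]
  simp [mul_sub, this]

/-- Young's inequality bounds the change of the squared norm by `η ‖A‖² + (1 + 1/η) ‖D‖²`, and `η`
is chosen after `ε` so that `η c < ε`. -/
theorem tendsto_mul_integral_norm_add_sq {A D : ℕ → Ω → ℂ} {r : ℕ → ℝ} (hr : ∀ n, 0 ≤ r n) {c : ℝ}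
    (hA : ∀ᶠ n in atTop, MemLp (A n) 2 P) (hD : ∀ᶠ n in atTop, MemLp (D n) 2 P)
    (hAc : Tendsto (fun n => r n * ∫ ω, ‖A n ω‖ ^ 2 ∂P) atTop (𝓝 c))
    (hD0 : Tendsto (fun n => r n * ∫ ω, ‖D n ω‖ ^ 2 ∂P) atTop (𝓝 0)) :
    Tendsto (fun n => r n * ∫ ω, ‖A n ω + D n ω‖ ^ 2 ∂P) atTop (𝓝 c) := by
  suffices h : Tendsto (fun n => r n * ∫ ω, ‖A n ω + D n ω‖ ^ 2 ∂P -
      r n * ∫ ω, ‖A n ω‖ ^ 2 ∂P) atTop (𝓝 0) by simpa using h.add hAc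
  rw [Metric.tendsto_atTop']
  have hc : 0 ≤ c := ge_of_tendsto' hAc fun n =>
    mul_nonneg (hr n) (integral_nonneg fun ω => sq_nonneg _)
  intro ε hε
  set η := ε / (2 * (c + 1)) with hη
  have hη0 : 0 < η := by positivity
  have hlim := (hAc.const_mul η).add (hD0.const_mul (1 + 1 / η))
  have hlt : η * c + (1 + 1 / η) * 0 < ε := by
    have : η * (c + 1) = ε / 2 := by rw [hη]; field_simp
    nlinarith
  obtain ⟨N, hN⟩ := eventually_atTop.1 ((hlim.eventually_lt_const hlt).and (hA.and hD))
  refine ⟨N, fun n hn => ?_⟩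
  obtain ⟨h1, h2, h3⟩ := hN n hn.le
  have iA := (memLp_two_iff_integrable_sq_norm h2.1).1 h2
  have iD := (memLp_two_iff_integrable_sq_norm h3.1).1 h3
  have iAD := (memLp_two_iff_integrable_sq_norm (h2.add h3).1).1 (h2.add h3)
  simp only [Pi.add_apply] at iAD
  rw [Real.dist_0_eq_abs, ← mul_sub, ← integral_sub iAD iA, abs_mul, abs_of_nonneg (hr n)]
  refine lt_of_le_of_lt ?_ h1
  calc r n * |∫ ω, (‖A n ω + D n ω‖ ^ 2 - ‖A n ω‖ ^ 2) ∂P|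
      ≤ r n * ∫ ω, (η * ‖A n ω‖ ^ 2 + (1 + 1 / η) * ‖D n ω‖ ^ 2) ∂P := by
        refine mul_le_mul_of_nonneg_left ?_ (hr n)
        refine (norm_integral_le_of_norm_le (G := ℝ) ((iA.const_mul η).add (iD.const_mul _))
          (.of_forall fun ω => ?_))
        have t1 : ‖A n ω + D n ω‖ ≤ ‖A n ω‖ + ‖D n ω‖ := norm_add_le _ _
        have t2 : ‖A n ω‖ ≤ ‖A n ω + D n ω‖ + ‖D n ω‖ := norm_le_add_norm_add _ _
        set a := ‖A n ω‖
        set d := ‖D n ω‖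
        set s := ‖A n ω + D n ω‖
        have ha : 0 ≤ a := norm_nonneg _
        have hd : 0 ≤ d := norm_nonneg _
        have hs : 0 ≤ s := norm_nonneg _
        have t3 : 2 * a * d ≤ η * a ^ 2 + (1 / η) * d ^ 2 := by
          have : 0 ≤ (η * a - d) ^ 2 / η := by positivity
          have e : (η * a - d) ^ 2 / η = η * a ^ 2 - 2 * a * d + (1 / η) * d ^ 2 := by
            field_simp; ring
          linarith
        rw [Real.norm_eq_abs, abs_le]
        have t4 : |s - a| ≤ d := abs_le.2 ⟨by linarith, by linarith⟩
        have t5 : |s ^ 2 - a ^ 2| ≤ d * (2 * a + d) := by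
          rw [sq_sub_sq, abs_mul, abs_of_nonneg (add_nonneg hs ha), mul_comm]
          exact mul_le_mul t4 (by linarith) (by linarith) hd
        have t6 := abs_le.1 t5
        constructor <;> nlinarith
    _ = _ := by
        rw [integral_add (iA.const_mul η) (iD.const_mul _), integral_const_mul, integral_const_mul]
        ring

variable [IsProbabilityMeasure P]

theorem complexVar_sub_const {Y : Ω → ℂ} (hY : Integrable Y P) (c : ℂ) :
    complexVar (fun ω => Y ω - c) P = complexVar Y P := by
  unfold complexVar
  rw [integral_sub hY (integrable_const c)]
  simp

theorem complexVar_eq_sub {Y : Ω → ℂ} (hY : MemLp Y 2 P) :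
    complexVar Y P = ∫ ω, ‖Y ω‖ ^ 2 ∂P - ‖∫ ω, Y ω ∂P‖ ^ 2 := by
  set m := ∫ ω, Y ω ∂P with hm
  have hYi := hY.integrable one_le_two
  have h1 : ∀ ω, ‖Y ω - m‖ ^ 2 =
      ‖Y ω‖ ^ 2 + 2 * ((starRingEnd ℂ) (-m) * Y ω).re + ‖m‖ ^ 2 := fun ω => by
    rw [sub_eq_neg_add, norm_add_sq_complex, norm_neg]; ring
  have h2 : Integrable (fun ω => ((starRingEnd ℂ) (-m) * Y ω).re) P := (hYi.const_mul _).re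
  have h3 : ∫ ω, ((starRingEnd ℂ) (-m) * Y ω).re ∂P = -‖m‖ ^ 2 := by
    have := integral_re (𝕜 := ℂ) (hYi.const_mul ((starRingEnd ℂ) (-m)))
    simp only [RCLike.re_eq_complex_re] at this
    rw [this, integral_const_mul, ← hm, map_neg, neg_mul, Complex.conj_mul']
    norm_cast
  have hsq := (memLp_two_iff_integrable_sq_norm hY.1).1 hY
  unfold complexVar
  rw [← hm]
  simp_rw [h1]
  have h4 : Integrable (fun ω => ‖Y ω‖ ^ 2 + 2 * ((starRingEnd ℂ) (-m) * Y ω).re) P :=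
    hsq.add (h2.const_mul 2)
  rw [integral_add h4 (integrable_const _),
    integral_add hsq (h2.const_mul 2), integral_const_mul, h3]
  simp
  ring

/-- Expansion of `E‖Y - E[Y] - T‖² ≥ 0`. A well-chosen test variable `T` thus gives a lower bound
for the variance from a covariance alone. -/
theorem le_complexVar {Y T : Ω → ℂ} (hY : MemLp Y 2 P) (hT : MemLp T 2 P)
    (hT0 : ∫ ω, T ω ∂P = 0) :
    2 * (∫ ω, (starRingEnd ℂ) (T ω) * Y ω ∂P).re - ∫ ω, ‖T ω‖ ^ 2 ∂P ≤ complexVar Y P := by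
  set m := ∫ ω, Y ω ∂P with hm
  have hTc : MemLp (fun ω => (starRingEnd ℂ) (T ω)) 2 P := hT.star
  have hi : Integrable (fun ω => (starRingEnd ℂ) (T ω) * Y ω) P := hTc.integrable_mul hY
  have hsq := (memLp_two_iff_integrable_sq_norm hT.1).1 hT
  have hYm : MemLp (fun ω => Y ω - m) 2 P := hY.sub (memLp_const m)
  have hi2 : Integrable (fun ω => (starRingEnd ℂ) (T ω) * (Y ω - m)) P := hTc.integrable_mul hYm
  have e1 : ∫ ω, (starRingEnd ℂ) (T ω) * Y ω ∂P = ∫ ω, (starRingEnd ℂ) (T ω) * (Y ω - m) ∂P := by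
    simp_rw [mul_sub]
    rw [integral_sub hi ((hTc.integrable one_le_two).mul_const _), integral_mul_const,
      integral_conj, hT0]
    simp
  have e2 := integral_re (𝕜 := ℂ) hi2
  simp only [RCLike.re_eq_complex_re] at e2
  have hi3 : Integrable (fun ω => 2 * ((starRingEnd ℂ) (T ω) * (Y ω - m)).re) P :=
    hi2.re.const_mul 2
  rw [e1, ← e2, ← integral_const_mul, ← integral_sub hi3 hsq]
  refine integral_mono (hi3.sub hsq)
    ((memLp_two_iff_integrable_sq_norm hYm.1).1 hYm) fun ω => ?_
  have h := norm_add_sq_complex (-T ω) (Y ω - m)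
  have h' := sq_nonneg ‖-T ω + (Y ω - m)‖
  rw [h, map_neg, neg_mul, Complex.neg_re, norm_neg] at h'
  simp only
  linarith

theorem integral_map_sub_eq_zero (hL : Integrable (Z 0) P) (L : ℂ →L[ℝ] ℝ) :
    ∫ ω, (L (Z 0 ω) - L (∫ ω', Z 0 ω' ∂P)) ∂P = 0 := by
  rw [integral_sub (L.integrable_comp hL) (integrable_const _), L.integral_comp_comm hL]
  simp

theorem nat_mul_integral_norm_sampleMean_sub_sq (hid : ∀ j, IdentDistrib (Z j) (Z 0) P P)
    (hind : iIndepFun Z P) (hL : MemLp (Z 0) 2 P) {n : ℕ} (hn : 0 < n) :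
    (n : ℝ) * ∫ ω, ‖sampleMean Z n ω - ∫ ω', Z 0 ω' ∂P‖ ^ 2 ∂P = complexVar (Z 0) P := by
  have hi := hL.integrable one_le_two
  have hn' : (n : ℝ) ≠ 0 := by exact_mod_cast hn.ne'
  set w := ∫ ω', Z 0 ω' ∂P with hw
  have key : ∀ L : ℂ →L[ℝ] ℝ, (n : ℝ) * ∫ ω, L (sampleMean Z n ω - w) ^ 2 ∂P =
      ∫ ω, L (Z 0 ω - w) ^ 2 ∂P := by
    intro L
    have h := integral_sum_sq (identDistrib_map_sub hid L (L w)) (iIndepFun_map_sub hind L (L w))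
      ((L.comp_memLp' hL).sub (memLp_const _)) (integral_map_sub_eq_zero hi L) (Finset.range n)
    simp only [map_sampleMean_sub L hn, mul_pow, integral_const_mul, h]
    simp only [Finset.card_range, map_sub]
    field_simp
  have hsplit : ∀ z : ℂ, ‖z‖ ^ 2 = Complex.reCLM z ^ 2 + Complex.imCLM z ^ 2 := fun z => by
    rw [← Complex.normSq_eq_norm_sq, Complex.normSq_apply]
    simp [sq]
  have hint : ∀ {V : Ω → ℂ} (L : ℂ →L[ℝ] ℝ), MemLp V 2 P → Integrable (fun ω => L (V ω) ^ 2) P :=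
    fun L hV => (L.comp_memLp' hV).integrable_sq
  have m1 : MemLp (fun ω => sampleMean Z n ω - w) 2 P :=
    (memLp_sampleMean hid hL n).sub (memLp_const _)
  have m2 : MemLp (fun ω => Z 0 ω - w) 2 P := hL.sub (memLp_const _)
  unfold complexVar
  simp_rw [← hw, hsplit]
  rw [integral_add (hint _ m1) (hint _ m1), integral_add (hint _ m2) (hint _ m2), mul_add,
    key, key]

/-- Reduction to the real statement for the real and imaginary parts: the larger one carries at
least half of the squared norm. -/
theorem tendsto_nat_mul_setIntegral_norm_sampleMean_sub_sq (hZ : ∀ j, Measurable (Z j))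
    (hid : ∀ j, IdentDistrib (Z j) (Z 0) P P)
    (hind : iIndepFun Z P) (hL : MemLp (Z 0) 2 P) {ρ : ℝ} (hρ : 0 < ρ) :
    Tendsto (fun n : ℕ => (n : ℝ) *
      ∫ ω in {ω | ρ ≤ ‖sampleMean Z n ω - ∫ ω', Z 0 ω' ∂P‖},
        ‖sampleMean Z n ω - ∫ ω', Z 0 ω' ∂P‖ ^ 2 ∂P) atTop (𝓝 0) := by
  have hi := hL.integrable one_le_two
  set w := ∫ ω', Z 0 ω' ∂P with hw
  have key : ∀ L : ℂ →L[ℝ] ℝ, Tendsto (fun n : ℕ => (n : ℝ) *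
      ∫ ω, L (sampleMean Z n ω - w) ^ 2 * min 1 |L (sampleMean Z n ω - w)| ∂P) atTop (𝓝 0) := by
    intro L
    have h := tendsto_nat_mul_integral_mean_sq_mul_min (ξ := fun j ω => L (Z j ω) - L w)
      (fun j => by have := hZ j; fun_prop)
      (identDistrib_map_sub hid L (L w)) (iIndepFun_map_sub hind L (L w))
      ((L.comp_memLp' hL).sub (memLp_const _)) (integral_map_sub_eq_zero hi L)
    refine h.congr' ?_
    filter_upwards [eventually_gt_atTop 0] with n hn
    simp only [map_sampleMean_sub L hn]
  -- The factor `2` pays for dropping the smaller coordinate; where `‖z‖ ≥ ρ` the larger coordinate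
  -- is at least `ρ / 2`, so its cut-off is at least `min 1 (ρ / 2)`.
  set K := 2 / min 1 (ρ / 2) with hK
  have hmin : 0 < min 1 (ρ / 2) := lt_min one_pos (by positivity)
  have hK0 : 0 < K := by positivity
  have hφ : ∀ x : ℝ, 0 ≤ min 1 |x| := fun x => le_min zero_le_one (abs_nonneg x)
  have hlim := ((key Complex.reCLM).add (key Complex.imCLM)).const_mul K
  rw [add_zero, mul_zero] at hlim
  refine squeeze_zero (fun n => mul_nonneg (Nat.cast_nonneg n) (integral_nonneg fun _ => sq_nonneg _))
    (fun n => ?_) hlim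
  have m1 : MemLp (fun ω => sampleMean Z n ω - w) 2 P :=
    (memLp_sampleMean hid hL n).sub (memLp_const _)
  have hWm := measurable_sampleMean hZ n
  have hint : ∀ (L : ℂ →L[ℝ] ℝ), Integrable (fun ω => L (sampleMean Z n ω - w) ^ 2 *
      min 1 |L (sampleMean Z n ω - w)|) P := fun L =>
    ((L.comp_memLp' m1).integrable_sq).mul_bdd (c := 1)
      (Measurable.aestronglyMeasurable (by fun_prop)) (.of_forall fun ω => by
        rw [Real.norm_of_nonneg (hφ _)]; exact min_le_left _ _)
  rw [← mul_add, ← integral_add (hint _) (hint _), mul_left_comm, ← integral_const_mul K]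
  refine mul_le_mul_of_nonneg_left ?_ (Nat.cast_nonneg n)
  have hs : MeasurableSet {ω | ρ ≤ ‖sampleMean Z n ω - w‖} :=
    measurableSet_le measurable_const (by fun_prop)
  rw [← integral_indicator hs]
  refine integral_mono (((memLp_two_iff_integrable_sq_norm m1.1).1 m1).indicator
    hs) (((hint _).add (hint _)).const_mul _)
    fun ω => ?_
  simp only [Complex.reCLM_apply, Complex.imCLM_apply]
  set z := sampleMean Z n ω - w
  have hn1 : 0 ≤ z.re ^ 2 * min 1 |z.re| := mul_nonneg (sq_nonneg _) (hφ _)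
  have hn2 : 0 ≤ z.im ^ 2 * min 1 |z.im| := mul_nonneg (sq_nonneg _) (hφ _)
  by_cases hω : ρ ≤ ‖z‖
  · rw [Set.indicator_of_mem (by exact hω)]
    have hz : ‖z‖ ^ 2 = z.re ^ 2 + z.im ^ 2 := by
      rw [← Complex.normSq_eq_norm_sq, Complex.normSq_apply]; ring
    have aux : ∀ x y : ℝ, |y| ≤ |x| → ρ ^ 2 ≤ x ^ 2 + y ^ 2 →
        x ^ 2 + y ^ 2 ≤ K * (x ^ 2 * min 1 |x|) := by
      intro x y hxy hρ'
      have h1 : y ^ 2 ≤ x ^ 2 := sq_le_sq.2 hxy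
      have h2 : ρ / 2 ≤ |x| := by
        refine abs_le_of_sq_le_sq' ?_ (abs_nonneg x) |>.2
        rw [sq_abs]; nlinarith
      have h3 : min 1 (ρ / 2) ≤ min 1 |x| := min_le_min_left _ h2
      calc x ^ 2 + y ^ 2 ≤ 2 * x ^ 2 := by linarith
        _ = K * (x ^ 2 * min 1 (ρ / 2)) := by rw [hK]; field_simp
        _ ≤ _ := by gcongr
    have hρ' : ρ ^ 2 ≤ z.re ^ 2 + z.im ^ 2 := by rw [← hz]; gcongr
    show ‖z‖ ^ 2 ≤ _
    rw [hz]
    rcases le_total |z.im| |z.re| with h | h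
    · have := aux _ _ h hρ'
      have := mul_nonneg hK0.le hn2
      linarith
    · have := aux _ _ h (by linarith)
      have := mul_nonneg hK0.le hn1
      linarith
  · rw [Set.indicator_of_notMem (by exact hω)]
    positivity

end Variance

end PowerMean

end

/-! ### The delta method under control by negative powers of a linear functional -/

noncomputable section

namespace PowerMean

/-- `g` is strictly differentiable on the half-plane `{L > 0}` with derivative `g'`, and `g`, `g'` are
controlled there by negative powers of `L`. -/
structure IsControlled (L : ℂ →L[ℝ] ℝ) (g g' : ℂ → ℂ) (C a b : ℝ) : Prop where
  measurable : Measurable g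
  nonneg_C : 0 ≤ C
  nonneg_a : 0 ≤ a
  nonneg_b : 0 ≤ b
  norm_le : ∀ w, 0 < L w → ‖g w‖ ≤ C * L w ^ (-a)
  hasStrictDerivAt : ∀ w, 0 < L w → HasStrictDerivAt g (g' w) w
  norm_deriv_le : ∀ w, 0 < L w → ‖g' w‖ ≤ C * L w ^ (-b)

section Delta

variable {L : ℂ →L[ℝ] ℝ} {g g' : ℂ → ℂ} {C a b : ℝ}

theorem IsControlled.norm_sub_le (h : IsControlled L g g' C a b) {δ : ℝ} (hδ : 0 < δ) {w w' : ℂ}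
    (hw : δ ≤ L w) (hw' : δ ≤ L w') : ‖g w - g w'‖ ≤ C * δ ^ (-b) * ‖w - w'‖ := by
  have hconv : Convex ℝ {z : ℂ | δ ≤ L z} := convex_halfSpace_ge L.toLinearMap.isLinear δ
  refine hconv.norm_image_sub_le_of_norm_hasDerivWithin_le (f := g) (f' := g') (fun z hz =>
    (h.hasStrictDerivAt z (hδ.trans_le hz)).hasDerivAt.hasDerivWithinAt) (fun z hz => ?_) hw' hw
  refine (h.norm_deriv_le z (hδ.trans_le hz)).trans ?_
  exact mul_le_mul_of_nonneg_left
    (Real.rpow_le_rpow_of_nonpos hδ hz (neg_nonpos.2 h.nonneg_b)) h.nonneg_C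

variable {Ω : Type*} [MeasurableSpace Ω] {P : Measure Ω} {Z : ℕ → Ω → ℂ} {β : ℝ}

/-- A sequence of i.i.d. complex variables in the half-plane `{L > 0}`, such that `L` of the first one
has a finite negative moment. -/
structure IsPositiveIID (L : ℂ →L[ℝ] ℝ) (Z : ℕ → Ω → ℂ) (β : ℝ) (P : Measure Ω) : Prop where
  measurable : ∀ j, Measurable (Z j)
  indep : iIndepFun Z P
  ident : ∀ j, IdentDistrib (Z j) (Z 0) P P
  integrable : Integrable (Z 0) P
  pos : ∀ᵐ ω ∂P, 0 < L (Z 0 ω)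
  pos_β : 0 < β
  negMoment : Integrable (fun ω => L (Z 0 ω) ^ (-β)) P

namespace IsPositiveIID

theorem ae_pos (h : IsPositiveIID L Z β P) : ∀ᵐ ω ∂P, ∀ j, 0 < L (Z j ω) :=
  ae_forall_of_identDistrib h.ident (p := fun z => 0 < L z)
    (measurableSet_lt measurable_const (by fun_prop)) h.pos

/-- For `k = 1` this gives the tail bounds for means that are independent of `Z 0`. -/
theorem shift (h : IsPositiveIID L Z β P) (k : ℕ) : IsPositiveIID L (fun j => Z (j + k)) β P where
  measurable j := h.measurable _
  indep := h.indep.precomp (add_left_injective k)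
  ident j := (h.ident _).trans (h.ident _).symm
  integrable := (h.ident _).symm.integrable_snd h.integrable
  pos := h.ae_pos.mono fun ω hω => hω _
  pos_β := h.pos_β
  negMoment := by
    have := ((h.ident (0 + k)).comp (u := fun z => L z ^ (-β)) (by fun_prop)).symm
    exact this.integrable_snd h.negMoment

theorem sampleMean_pos (h : IsPositiveIID L Z β P) {n : ℕ} (hn : 0 < n) :
    ∀ᵐ ω ∂P, 0 < L (sampleMean Z n ω) := by
  filter_upwards [h.ae_pos] with ω hω
  have hn' : (0 : ℝ) < n := by exact_mod_cast hn
  rw [map_sampleMean]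
  exact mul_pos (by positivity) (Finset.sum_pos (fun j _ => hω j) (by simpa using hn.ne'))

theorem ae_tendsto_sampleMean (h : IsPositiveIID L Z β P) :
    ∀ᵐ ω ∂P, Tendsto (fun n => sampleMean Z n ω) atTop (𝓝 (∫ ω, Z 0 ω ∂P)) := by
  filter_upwards [strong_law_ae Z h.integrable (fun i j hij => h.indep.indepFun hij) h.ident]
    with ω hω
  simpa [sampleMean] using hω

theorem measurable_comp (h : IsPositiveIID L Z β P) (hg : Measurable g) (n : ℕ) :
    Measurable fun ω => g (sampleMean Z n ω) :=
  hg.comp (measurable_sampleMean h.measurable n)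

variable [IsProbabilityMeasure P]

theorem integral_pos (h : IsPositiveIID L Z β P) : 0 < L (∫ ω, Z 0 ω ∂P) := by
  rw [← L.integral_comp_comm h.integrable]
  exact integral_pos_of_ae_pos (L.integrable_comp h.integrable) h.pos

theorem eventually_integrable_rpow (h : IsPositiveIID L Z β P) {t : ℝ} (ht : 0 ≤ t) :
    ∀ᶠ n : ℕ in atTop, Integrable (fun ω => L (sampleMean Z n ω) ^ (-t)) P := by
  have hb : Tendsto (fun n : ℕ => β * n) atTop atTop :=
    tendsto_natCast_atTop_atTop.const_mul_atTop h.pos_β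
  filter_upwards [eventually_gt_atTop 0, hb.eventually_ge_atTop t] with n hn htn
  simp only [map_sampleMean]
  exact (integrable_mean_rpow_neg (Y := fun j ω => L (Z j ω))
    (fun j => by have := h.measurable j; fun_prop)
    (h.indep.comp (fun _ => L) fun _ => by fun_prop) (fun j => (h.ident j).comp (by fun_prop)) h.pos
    h.pos_β h.negMoment hn ht htn one_pos).1

theorem exists_tendsto_nat_mul_setIntegral (h : IsPositiveIID L Z β P) {ε : ℝ} (hε : 0 < ε) :
    ∃ δ, 0 < δ ∧ δ < ε ∧ ∀ t : ℝ, 0 ≤ t → Tendsto (fun n : ℕ => (n : ℝ) *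
      ∫ ω in {ω | L (sampleMean Z n ω) < δ}, L (sampleMean Z n ω) ^ (-t) ∂P) atTop (𝓝 0) := by
  obtain ⟨δ, hδ, hδε, hδA⟩ := exists_pos_rpow_mul_lt_one h.pos_β (∫ ω, L (Z 0 ω) ^ (-β) ∂P) hε
  refine ⟨δ, hδ, hδε, fun t ht => ?_⟩
  simp only [map_sampleMean]
  exact tendsto_nat_mul_mean_rpow_neg (Y := fun j ω => L (Z j ω))
    (fun j => by have := h.measurable j; fun_prop)
    (h.indep.comp (fun _ => L) fun _ => by fun_prop) (fun j => (h.ident j).comp (by fun_prop)) h.pos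
    h.pos_β h.negMoment ht hδ hδA

theorem eventually_memLp (h : IsPositiveIID L Z β P) (hg : IsControlled L g g' C a b) :
    ∀ᶠ n : ℕ in atTop, MemLp (fun ω => g (sampleMean Z n ω)) 2 P := by
  filter_upwards [eventually_gt_atTop 0,
    h.eventually_integrable_rpow (mul_nonneg zero_le_two hg.nonneg_a)] with n hn hi
  have hm := (h.measurable_comp hg.measurable n).aestronglyMeasurable (μ := P)
  rw [memLp_two_iff_integrable_sq_norm hm]
  refine (hi.const_mul (C ^ 2)).mono' (hm.norm.pow 2) ?_
  filter_upwards [h.sampleMean_pos hn] with ω hω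
  rw [Real.norm_of_nonneg (sq_nonneg _)]
  calc _ ≤ (C * L (sampleMean Z n ω) ^ (-a)) ^ 2 := by gcongr; exact hg.norm_le _ hω
    _ = _ := by
      rw [mul_pow, ← Real.rpow_mul_natCast hω.le]
      congr 2
      push_cast; ring

/-- The remainder in the first-order expansion of `g (sampleMean Z n)` is `o(n⁻¹)` in mean square. -/
theorem tendsto_nat_mul_integral_remainder (h : IsPositiveIID L Z β P)
    (hg : IsControlled L g g' C a b) (hZ2 : MemLp (Z 0) 2 P) {w : ℂ} (hw : w = ∫ ω, Z 0 ω ∂P) :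
    Tendsto (fun n : ℕ => (n : ℝ) *
      ∫ ω, ‖g (sampleMean Z n ω) - g w - g' w * (sampleMean Z n ω - w)‖ ^ 2 ∂P) atTop (𝓝 0) := by
  have hLw : 0 < L w := hw ▸ h.integral_pos
  obtain ⟨δ, hδ, hδw, htail⟩ := h.exists_tendsto_nat_mul_setIntegral (half_pos hLw)
  have hδw' : 0 < L w - δ := by linarith
  set V := complexVar (Z 0) P with hV
  have hV0 : 0 ≤ V := integral_nonneg fun _ => sq_nonneg _
  -- The term `ε² V` comes from differentiability on a ball around `w`, since `n E‖W_n - w‖² = V`;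
  -- the null sequence `v` collects everything outside the ball.
  have main : ∀ ε : ℝ, 0 < ε → ∃ v : ℕ → ℝ, Tendsto v atTop (𝓝 0) ∧ ∀ᶠ n : ℕ in atTop, (n : ℝ) *
      ∫ ω, ‖g (sampleMean Z n ω) - g w - g' w * (sampleMean Z n ω - w)‖ ^ 2 ∂P ≤
        ε ^ 2 * V + v n := by
    intro ε hε
    have hd := (hg.hasStrictDerivAt w hLw).hasDerivAt.isLittleO
    obtain ⟨ρ₀, hρ₀, hd⟩ := Metric.eventually_nhds_iff.1 (hd.def hε)
    set ρ := min ρ₀ (L w - δ) with hρ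
    have hρ0 : 0 < ρ := lt_min hρ₀ hδw'
    -- Outside the ball: the first square is the Lipschitz bound on `{L ≥ δ}`, the second bounds all
    -- terms but `g (W_n)` on `{L < δ}`, using `1 ≤ ‖z - w‖ / ρ`. The term `g (W_n)` itself is paid
    -- for by `K₂`.
    set K₁ := (C * δ ^ (-b) + ‖g' w‖) ^ 2 + 2 * (‖g w‖ / ρ + ‖g' w‖) ^ 2 with hK₁
    set K₂ := 2 * C ^ 2 with hK₂
    have t1 := tendsto_nat_mul_setIntegral_norm_sampleMean_sub_sq h.measurable h.ident h.indep hZ2 hρ0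
    have t2 := htail (2 * a) (mul_nonneg zero_le_two hg.nonneg_a)
    have t3 := (t1.const_mul K₁).add (t2.const_mul K₂)
    rw [mul_zero, mul_zero, add_zero] at t3
    refine ⟨_, t3, ?_⟩
    filter_upwards [eventually_gt_atTop 0, h.eventually_memLp hg,
      h.eventually_integrable_rpow (mul_nonneg zero_le_two hg.nonneg_a)] with n hn hgL hi
    rw [← hw]
    have m1 : MemLp (fun ω => sampleMean Z n ω - w) 2 P :=
      (memLp_sampleMean h.ident hZ2 n).sub (memLp_const _)
    have i1 := (memLp_two_iff_integrable_sq_norm m1.1).1 m1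
    have m2 : MemLp (fun ω => g (sampleMean Z n ω) - g w - g' w * (sampleMean Z n ω - w)) 2 P :=
      (hgL.sub (memLp_const _)).sub (m1.const_mul _)
    have hWm := measurable_sampleMean h.measurable n
    have hs1 : MeasurableSet {ω | ρ ≤ ‖sampleMean Z n ω - w‖} :=
      measurableSet_le measurable_const (by fun_prop)
    have hs2 : MeasurableSet {ω | L (sampleMean Z n ω) < δ} :=
      measurableSet_lt (by fun_prop) measurable_const
    have hVn := nat_mul_integral_norm_sampleMean_sub_sq h.ident h.indep hZ2 hn
    rw [← hw, ← hV] at hVn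
    rw [← integral_indicator hs1, ← integral_indicator hs2, ← hVn]
    have i2 := i1.indicator hs1
    have i3 := hi.indicator hs2
    have i12 : Integrable (fun ω => ε ^ 2 * ‖sampleMean Z n ω - w‖ ^ 2 +
      K₁ * {ω | ρ ≤ ‖sampleMean Z n ω - w‖}.indicator (fun ω => ‖sampleMean Z n ω - w‖ ^ 2) ω) P :=
      (i1.const_mul _).add (i2.const_mul _)
    calc _ ≤ (n : ℝ) * ∫ ω, (ε ^ 2 * ‖sampleMean Z n ω - w‖ ^ 2 +
          K₁ * {ω | ρ ≤ ‖sampleMean Z n ω - w‖}.indicator (fun ω => ‖sampleMean Z n ω - w‖ ^ 2) ω +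
          K₂ * {ω | L (sampleMean Z n ω) < δ}.indicator
            (fun ω => L (sampleMean Z n ω) ^ (-(2 * a))) ω) ∂P := by
          refine mul_le_mul_of_nonneg_left ?_ (Nat.cast_nonneg n)
          refine integral_mono_ae ((memLp_two_iff_integrable_sq_norm m2.1).1 m2)
            (i12.add (i3.const_mul _)) ?_
          filter_upwards [h.sampleMean_pos hn] with ω hω
          generalize hz : sampleMean Z n ω = z at hω
          have hK₁0 : 0 ≤ K₁ := by positivity
          have hK₂0 : 0 ≤ K₂ := by positivity
          have hp1 : 0 ≤ ε ^ 2 * ‖z - w‖ ^ 2 := by positivity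
          have hp3 : 0 ≤ K₂ * {ω | L (sampleMean Z n ω) < δ}.indicator
              (fun ω => L (sampleMean Z n ω) ^ (-(2 * a))) ω := by
            refine mul_nonneg hK₂0 (Set.indicator_apply_nonneg fun _ => ?_)
            rw [hz]; positivity
          by_cases hzρ : ‖z - w‖ < ρ
          · have h1 := hd (y := z) (by rw [dist_eq_norm]; exact hzρ.trans_le (min_le_left _ _))
            have hp2 : 0 ≤ K₁ * {ω | ρ ≤ ‖sampleMean Z n ω - w‖}.indicator
              (fun ω => ‖sampleMean Z n ω - w‖ ^ 2) ω :=
              mul_nonneg hK₁0 (Set.indicator_nonneg (fun _ _ => sq_nonneg _) _)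
            rw [smul_eq_mul, mul_comm (z - w)] at h1
            have h2 : ‖g z - g w - g' w * (z - w)‖ ^ 2 ≤ ε ^ 2 * ‖z - w‖ ^ 2 := by
              rw [← mul_pow]; gcongr
            linarith
          · rw [not_lt] at hzρ
            have hp2 : {ω | ρ ≤ ‖sampleMean Z n ω - w‖}.indicator
              (fun ω => ‖sampleMean Z n ω - w‖ ^ 2) ω = ‖z - w‖ ^ 2 := by
              rw [Set.indicator_of_mem (by simpa [hz] using hzρ), hz]
            rw [hp2]
            have hb1 : ‖g' w * (z - w)‖ = ‖g' w‖ * ‖z - w‖ := norm_mul _ _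
            by_cases hzδ : L z < δ
            · have hp3' : {ω | L (sampleMean Z n ω) < δ}.indicator
                (fun ω => L (sampleMean Z n ω) ^ (-(2 * a))) ω = L z ^ (-(2 * a)) := by
                rw [Set.indicator_of_mem (by simpa [hz] using hzδ), hz]
              rw [hp3']
              have h1 : ‖g z - g w - g' w * (z - w)‖ ≤
                  C * L z ^ (-a) + (‖g w‖ / ρ + ‖g' w‖) * ‖z - w‖ := by
                have h2 : ‖g w‖ ≤ ‖g w‖ / ρ * ‖z - w‖ := by
                  rw [div_mul_eq_mul_div, le_div_iff₀ hρ0]; gcongr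
                have h3 := hg.norm_le z hω
                have h4 := norm_sub_le (g z - g w) (g' w * (z - w))
                have h5 := norm_sub_le (g z) (g w)
                rw [hb1] at h4
                linarith
              have h2 : (C * L z ^ (-a)) ^ 2 = C ^ 2 * L z ^ (-(2 * a)) := by
                rw [mul_pow, ← Real.rpow_mul_natCast hω.le]
                congr 2
                push_cast; ring
              have h3 : 0 ≤ (C * δ ^ (-b) + ‖g' w‖) ^ 2 * ‖z - w‖ ^ 2 := by positivity
              calc ‖g z - g w - g' w * (z - w)‖ ^ 2
                  ≤ (C * L z ^ (-a) + (‖g w‖ / ρ + ‖g' w‖) * ‖z - w‖) ^ 2 := by gcongr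
                _ ≤ 2 * ((C * L z ^ (-a)) ^ 2 + ((‖g w‖ / ρ + ‖g' w‖) * ‖z - w‖) ^ 2) := add_sq_le
                _ ≤ _ := by rw [h2, mul_pow, hK₁, hK₂]; linarith
            · rw [not_lt] at hzδ
              have h1 := hg.norm_sub_le hδ hzδ (by linarith : δ ≤ L w)
              have h2 : ‖g z - g w - g' w * (z - w)‖ ≤ (C * δ ^ (-b) + ‖g' w‖) * ‖z - w‖ := by
                have h4 := norm_sub_le (g z - g w) (g' w * (z - w))
                rw [hb1] at h4
                linarith
              have h3 : 0 ≤ 2 * (‖g w‖ / ρ + ‖g' w‖) ^ 2 * ‖z - w‖ ^ 2 := by positivity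
              calc ‖g z - g w - g' w * (z - w)‖ ^ 2
                  ≤ ((C * δ ^ (-b) + ‖g' w‖) * ‖z - w‖) ^ 2 := by gcongr
                _ = (C * δ ^ (-b) + ‖g' w‖) ^ 2 * ‖z - w‖ ^ 2 := mul_pow _ _ _
                _ ≤ _ := by rw [hK₁]; linarith
      _ = _ := by
          rw [integral_add i12 (i3.const_mul _), integral_add (i1.const_mul _) (i2.const_mul _),
            integral_const_mul, integral_const_mul, integral_const_mul]
          ring
  rw [Metric.tendsto_atTop']
  intro η hη
  obtain ⟨v, hv, hle⟩ := main (√(η / (2 * (V + 1)))) (Real.sqrt_pos.2 (by positivity))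
  rw [Real.sq_sqrt (by positivity)] at hle
  have hlt : η / (2 * (V + 1)) * V < η / 2 := by
    rw [div_mul_eq_mul_div, div_lt_div_iff₀ (by positivity) two_pos]
    nlinarith
  obtain ⟨N, hN⟩ := eventually_atTop.1 (hle.and (hv.eventually_lt_const (half_pos hη)))
  refine ⟨N, fun n hn => ?_⟩
  obtain ⟨h1, h2⟩ := hN n hn.le
  rw [Real.dist_0_eq_abs, abs_of_nonneg
    (mul_nonneg n.cast_nonneg (integral_nonneg fun _ => sq_nonneg _))]
  linarith

/-- The delta method for variances. -/
theorem tendsto_nat_mul_complexVar (h : IsPositiveIID L Z β P)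
    (hg : IsControlled L g g' C a b) (hZ2 : MemLp (Z 0) 2 P) :
    Tendsto (fun n : ℕ => (n : ℝ) * complexVar (fun ω => g (sampleMean Z n ω)) P) atTop
      (𝓝 (‖g' (∫ ω, Z 0 ω ∂P)‖ ^ 2 * complexVar (Z 0) P)) := by
  set w := ∫ ω, Z 0 ω ∂P with hw
  have hrem := h.tendsto_nat_mul_integral_remainder hg hZ2 hw
  set R : ℕ → Ω → ℂ := fun n ω => g (sampleMean Z n ω) - g w - g' w * (sampleMean Z n ω - w) with hR
  have m1 : ∀ n, MemLp (fun ω => g' w * (sampleMean Z n ω - w)) 2 P := fun n =>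
    ((memLp_sampleMean h.ident hZ2 n).sub (memLp_const _)).const_mul _
  have m2 : ∀ᶠ n in atTop, MemLp (R n) 2 P := by
    filter_upwards [h.eventually_memLp hg] with n hn
    exact (hn.sub (memLp_const _)).sub (m1 n)
  -- The linear term has mean zero, so the centred variable is the linear term plus the centred
  -- remainder.
  have key := tendsto_mul_integral_norm_add_sq (P := P) (r := fun n : ℕ => (n : ℝ))
    (A := fun n ω => g' w * (sampleMean Z n ω - w)) (D := fun n ω => R n ω - ∫ ω', R n ω' ∂P)
    (c := ‖g' w‖ ^ 2 * complexVar (Z 0) P) (fun n => n.cast_nonneg) (.of_forall m1)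
    (m2.mono fun n hn => hn.sub (memLp_const _)) ?_ ?_
  · refine key.congr' ?_
    filter_upwards [eventually_gt_atTop 0, h.eventually_memLp hg] with n hn hgn
    unfold complexVar
    congr 1
    refine integral_congr_ae (.of_forall fun ω => ?_)
    have hgi := hgn.integrable one_le_two
    have hi := (m1 n).integrable one_le_two
    have e1 : ∫ ω, g' w * (sampleMean Z n ω - w) ∂P = 0 := by
      rw [integral_const_mul, integral_sub ((memLp_sampleMean h.ident hZ2 n).integrable one_le_two)
        (integrable_const _), integral_sampleMean h.ident h.integrable hn]
      simp [hw]
    have e2 : ∫ ω, R n ω ∂P = ∫ ω, g (sampleMean Z n ω) ∂P - g w := by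
      have : Integrable (fun ω => g (sampleMean Z n ω) - g w) P := hgi.sub (integrable_const _)
      rw [integral_sub this hi, e1, integral_sub hgi (integrable_const _)]
      simp
    rw [e2]
    simp only [hR]
    congr 2
    ring
  · refine Tendsto.congr' (f₁ := fun _ => ‖g' w‖ ^ 2 * complexVar (Z 0) P) ?_ tendsto_const_nhds
    filter_upwards [eventually_gt_atTop 0] with n hn
    simp only [norm_mul, mul_pow, integral_const_mul]
    rw [← nat_mul_integral_norm_sampleMean_sub_sq h.ident h.indep hZ2 hn]
    ring
  · refine squeeze_zero' (.of_forall fun n => mul_nonneg n.cast_nonneg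
      (integral_nonneg fun _ => sq_nonneg _)) ?_ hrem
    filter_upwards [m2] with n hn
    refine mul_le_mul_of_nonneg_left ?_ (Nat.cast_nonneg n)
    have := complexVar_eq_sub hn
    unfold complexVar at this
    rw [this]
    exact sub_le_self _ (sq_nonneg _)

end IsPositiveIID

end Delta

end PowerMean

end

/-! ### Lower bounds by projection, and infinite asymptotic variance -/

noncomputable section

namespace PowerMean

namespace IsPositiveIID

variable {L : ℂ →L[ℝ] ℝ} {g g' : ℂ → ℂ} {C a b : ℝ}
variable {Ω : Type*} [MeasurableSpace Ω] {P : Measure Ω} {Z : ℕ → Ω → ℂ} {β : ℝ}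

theorem _root_.PowerMean.sampleMean_succ {Ω : Type*} (Z : ℕ → Ω → ℂ) (n : ℕ) (ω : Ω) :
    sampleMean Z (n + 1) ω =
      ((n : ℂ) + 1)⁻¹ * (n * sampleMean (fun j => Z (j + 1)) n ω + Z 0 ω) := by
  unfold sampleMean
  rw [Finset.sum_range_succ']
  rcases Nat.eq_zero_or_pos n with rfl | hn
  · simp
  · have : (n : ℂ) ≠ 0 := by exact_mod_cast hn.ne'
    push_cast
    rw [mul_inv_cancel_left₀ this]

/-- Adjoining one more point of the half-plane to a mean of `n ≥ 1` points leaves at least the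
fraction `n / (n + 1) ≥ 1 / 2` of `L`. -/
theorem _root_.PowerMean.half_le_map_update_mean {n : ℕ} (hn : 0 < n) {s z : ℂ} (hs : 0 < L s)
    (hz : 0 < L z) : L s / 2 ≤ L (((n : ℂ) + 1)⁻¹ * (n * s + z)) := by
  have hn' : (1 : ℝ) ≤ n := by exact_mod_cast hn
  have : ((n : ℂ) + 1)⁻¹ * (n * s + z) = ((n : ℝ) + 1)⁻¹ • ((n : ℝ) • s + z) := by
    rw [Complex.real_smul, Complex.real_smul]; push_cast; rfl
  rw [this, map_smul, map_add, map_smul, smul_eq_mul, smul_eq_mul, ← div_eq_inv_mul,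
    div_le_div_iff₀ two_pos (by positivity)]
  nlinarith

theorem indepFun_zero_sampleMean_shift (h : IsPositiveIID L Z β P) (n : ℕ) :
    IndepFun (Z 0) (sampleMean (fun j => Z (j + 1)) n) P := by
  have := (h.indep.indepFun_finsetSum_of_notMem h.measurable
    (s := (Finset.range n).map ⟨Nat.succ, Nat.succ_injective⟩) (i := 0) (by simp)).symm
  have h2 := this.comp (φ := id) (ψ := fun z => (n : ℂ)⁻¹ * z) measurable_id (by fun_prop)
  have h3 : sampleMean (fun j => Z (j + 1)) n = (fun z => (n : ℂ)⁻¹ * z) ∘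
      ∑ j ∈ (Finset.range n).map ⟨Nat.succ, Nat.succ_injective⟩, Z j := by
    ext ω
    simp [sampleMean]
  rw [h3]
  exact h2

theorem ae_tendsto_update_mean (h : IsPositiveIID L Z β P) (w : ℂ) :
    ∀ᵐ ω ∂P, Tendsto (fun n : ℕ =>
      ((n : ℂ) + 1)⁻¹ * (n * sampleMean (fun j => Z (j + 1)) n ω + w)) atTop
        (𝓝 (∫ ω, Z 0 ω ∂P)) := by
  filter_upwards [h.ae_tendsto_sampleMean] with ω hω
  have h1 := (tendsto_add_atTop_iff_nat 1).2 hω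
  have h2 : Tendsto (fun n : ℕ => ((n : ℂ) + 1)⁻¹) atTop (𝓝 0) := by
    simpa using tendsto_one_div_add_atTop_nhds_zero_nat (𝕜 := ℂ)
  have h3 := h1.add (h2.mul_const (w - Z 0 ω))
  rw [zero_mul, add_zero] at h3
  refine h3.congr fun n => ?_
  rw [sampleMean_succ]
  ring

/-- Both points of the difference quotient move with `n`, hence strict differentiability. -/
theorem _root_.PowerMean.tendsto_mul_sub_of_hasStrictDerivAt {w c : ℂ} (hg : HasStrictDerivAt g c w)
    {u v : ℕ → ℂ} (hu : Tendsto u atTop (𝓝 w)) (hv : Tendsto v atTop (𝓝 w)) {d : ℂ}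
    (huv : ∀ n : ℕ, u n - v n = ((n : ℂ) + 1)⁻¹ * d) :
    Tendsto (fun n : ℕ => ((n : ℂ) + 1) * (g (u n) - g (v n))) atTop (𝓝 (c * d)) := by
  have hne : ∀ n : ℕ, (n : ℂ) + 1 ≠ 0 := fun n => by exact_mod_cast n.succ_ne_zero
  have h1 := hg.isLittleO.comp_tendsto (hu.prodMk_nhds hv)
  have h2 : (fun n : ℕ => ((n : ℂ) + 1) * (g (u n) - g (v n)) - c * d) =o[atTop]
      fun _ : ℕ => (1 : ℂ) := by
    have h3 := (Asymptotics.isBigO_refl (fun n : ℕ => (n : ℂ) + 1) atTop).mul_isLittleO h1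
    refine (h3.congr_left fun n => ?_).trans_isBigO ?_
    · simp only [Function.comp, huv, ContinuousLinearMap.toSpanSingleton_apply, smul_eq_mul]
      field_simp [hne n]
    · refine Asymptotics.IsBigO.of_bound ‖d‖ (.of_forall fun n => ?_)
      simp only [Function.comp, huv]
      rw [mul_inv_cancel_left₀ (hne n)]
      simp
  simpa using ((Asymptotics.isLittleO_one_iff ℂ).1 h2).add_const (c * d)

/-- The sample mean is symmetric in its entries, so the transposition of `0` and `j` changes
nothing. -/
theorem integral_mul_sampleMean_eq (h : IsPositiveIID L Z β P) (hg : Measurable g)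
    {κ : ℂ → ℂ} (hκ : Measurable κ) {n j : ℕ} (hj : j < n) :
    ∫ ω, κ (Z j ω) * g (sampleMean Z n ω) ∂P = ∫ ω, κ (Z 0 ω) * g (sampleMean Z n ω) ∂P := by
  have h1 := identDistrib_precomp_injective h.indep h.ident
    (Equiv.swap 0 j).injective Function.injective_id
  have h2 := h1.comp (u := fun z : ℕ → ℂ => κ (z 0) * g ((n : ℂ)⁻¹ * ∑ i ∈ Finset.range n, z i))
    (by fun_prop)
  have h3 := h2.integral_eq
  simp only [Function.comp, Equiv.swap_apply_left, id] at h3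
  unfold sampleMean
  rw [← h3]
  refine integral_congr_ae (.of_forall fun ω => ?_)
  simp only
  congr 3
  refine (Finset.sum_equiv (Equiv.swap 0 j) (fun i => ?_) fun i _ => rfl).symm
  simp only [Finset.mem_range]
  rcases eq_or_ne i 0 with rfl | hi0
  · simp [hj]; omega
  · rcases eq_or_ne i j with rfl | hij
    · simp; omega
    · rw [Equiv.swap_apply_of_ne_of_ne hi0 hij]

variable [IsProbabilityMeasure P]

/-- The covariance of `g (sampleMean Z n)` with a bounded function of one of the variables. -/
theorem tendsto_nat_mul_integral_mul (h : IsPositiveIID L Z β P) (hg : IsControlled L g g' C a b)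
    {κ : ℂ → ℂ} (hκ : Measurable κ) {B : ℝ} (hB : ∀ z, ‖κ z‖ ≤ B) (hκ0 : ∫ ω, κ (Z 0 ω) ∂P = 0)
    {w : ℂ} (hw : w = ∫ ω, Z 0 ω ∂P) :
    Tendsto (fun n : ℕ => (n : ℂ) * ∫ ω, κ (Z 0 ω) * g (sampleMean Z n ω) ∂P) atTop
      (𝓝 (∫ ω, κ (Z 0 ω) * (g' w * (Z 0 ω - w)) ∂P)) := by
  -- With `n + 1` variables, the `n` variables other than `Z 0` have the mean `S n`.
  rw [← tendsto_add_atTop_iff_nat 1]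
  have hB0 : 0 ≤ B := (norm_nonneg _).trans (hB 0)
  have hLw : 0 < L w := hw ▸ h.integral_pos
  have hs := h.shift 1
  have hsw : ∫ ω, Z (0 + 1) ω ∂P = w := hw ▸ (h.ident 1).integral_eq
  obtain ⟨δ, hδ, hδw, htail⟩ := hs.exists_tendsto_nat_mul_setIntegral hLw
  set S : ℕ → Ω → ℂ := sampleMean fun j => Z (j + 1) with hS
  have hSm : ∀ n, Measurable (S n) := measurable_sampleMean hs.measurable
  have hZ0 := h.measurable 0
  have hgm := hg.measurable
  set U : ℕ → Ω → ℂ := fun n ω => ((n : ℂ) + 1)⁻¹ * (n * S n ω + Z 0 ω) with hU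
  -- The full mean with `Z 0` replaced by its expectation. It is independent of `Z 0`, so `κ (Z 0) g
  -- (U')` has mean zero and may be subtracted; only the increment of `g` from `U'` to `U`, of order
  -- `1/n`, remains.
  set U' : ℕ → Ω → ℂ := fun n ω => ((n : ℂ) + 1)⁻¹ * (n * S n ω + w) with hU'
  have hUm : ∀ n, Measurable (U n) := fun n => by have := hSm n; fun_prop
  have hU'm : ∀ n, Measurable (U' n) := fun n => by have := hSm n; fun_prop
  set D : ℕ → Ω → ℂ := fun n ω => ((n : ℂ) + 1) * (κ (Z 0 ω) * (g (U n ω) - g (U' n ω))) with hD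
  have hDm : ∀ n, Measurable (D n) := fun n => by have := hUm n; have := hU'm n; fun_prop
  have hbad : ∀ n, MeasurableSet {ω | L (S n ω) < δ} := fun n =>
    measurableSet_lt (by have := hSm n; fun_prop) measurable_const
  have hcrude : ∀ n : ℕ, 0 < n → ∀ᵐ ω ∂P, ‖g (U n ω)‖ ≤ C * (2 ^ a * L (S n ω) ^ (-a)) ∧
      ‖g (U' n ω)‖ ≤ C * (2 ^ a * L (S n ω) ^ (-a)) := by
    intro n hn
    filter_upwards [hs.sampleMean_pos hn, h.pos] with ω h1 h2
    have key : ∀ z, 0 < L z → ‖g (((n : ℂ) + 1)⁻¹ * (n * S n ω + z))‖ ≤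
        C * (2 ^ a * L (S n ω) ^ (-a)) := by
      intro z hz
      have h3 := half_le_map_update_mean hn h1 hz
      refine (hg.norm_le _ ((half_pos h1).trans_le h3)).trans
        (mul_le_mul_of_nonneg_left ?_ hg.nonneg_C)
      refine (Real.rpow_le_rpow_of_nonpos (half_pos h1) h3 (neg_nonpos.2 hg.nonneg_a)).trans_eq ?_
      rw [div_eq_mul_inv, Real.mul_rpow h1.le (by norm_num), Real.inv_rpow (by norm_num),
        Real.rpow_neg two_pos.le, inv_inv, mul_comm]
    exact ⟨key _ h2, key _ hLw⟩
  have hint : ∀ᶠ n : ℕ in atTop, Integrable (fun ω => g (U n ω)) P ∧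
      Integrable (fun ω => g (U' n ω)) P := by
    filter_upwards [eventually_gt_atTop 0, hs.eventually_integrable_rpow hg.nonneg_a] with n hn hi
    have hi' := (hi.const_mul (2 ^ a)).const_mul C
    exact ⟨hi'.mono' (hgm.comp (hUm n)).aestronglyMeasurable ((hcrude n hn).mono fun ω h => h.1),
      hi'.mono' (hgm.comp (hU'm n)).aestronglyMeasurable ((hcrude n hn).mono fun ω h => h.2)⟩
  have hκint : ∀ {f : Ω → ℂ}, Integrable f P → Integrable (fun ω => κ (Z 0 ω) * f ω) P :=
    fun hf => hf.bdd_mul (c := B) (hκ.comp hZ0).aestronglyMeasurable (.of_forall fun _ => hB _)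
  have heq : ∀ᶠ n : ℕ in atTop, ∫ ω, D n ω ∂P =
      ((n + 1 : ℕ) : ℂ) * ∫ ω, κ (Z 0 ω) * g (sampleMean Z (n + 1) ω) ∂P := by
    filter_upwards [hint] with n hn
    have e1 : ∫ ω, κ (Z 0 ω) * g (U' n ω) ∂P = 0 := by
      have := (h.indepFun_zero_sampleMean_shift n).integral_fun_comp_mul_comp (f := κ)
        (g := fun z => g (((n : ℂ) + 1)⁻¹ * (n * z + w))) hZ0.aemeasurable (hSm n).aemeasurable
        hκ.aestronglyMeasurable (Measurable.aestronglyMeasurable (by fun_prop))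
      rw [hκ0, zero_mul] at this
      exact this
    simp only [hD, mul_sub]
    rw [integral_sub ((hκint hn.1).const_mul _) ((hκint hn.2).const_mul _), integral_const_mul,
      integral_const_mul, e1, mul_zero, sub_zero]
    simp only [sampleMean_succ]
    push_cast
    rfl
  refine Tendsto.congr' heq ?_
  have hDint : ∀ᶠ n : ℕ in atTop, Integrable (D n) P := by
    filter_upwards [hint] with n hn using (hκint (hn.1.sub hn.2)).const_mul _
  have hsplit : ∀ᶠ n : ℕ in atTop, ∫ ω, {ω | L (S n ω) < δ}ᶜ.indicator (D n) ω ∂P +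
      ∫ ω, {ω | L (S n ω) < δ}.indicator (D n) ω ∂P = ∫ ω, D n ω ∂P := by
    filter_upwards [hDint] with n hn
    rw [integral_indicator (hbad n).compl, integral_indicator (hbad n), add_comm]
    exact integral_add_compl (hbad n) hn
  refine Tendsto.congr' hsplit ?_
  rw [← add_zero (∫ ω, κ (Z 0 ω) * (g' w * (Z 0 ω - w)) ∂P)]
  refine Tendsto.add ?_ ?_
  -- Where `L (S n) ≥ δ`, both means satisfy `L ≥ δ / 2` and the Lipschitz bound gives a dominating
  -- multiple of `‖Z 0 - w‖`. Boundedness of `κ` makes a first moment sufficient.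
  · have hZw : Integrable (fun ω => ‖Z 0 ω - w‖) P := (h.integrable.sub (integrable_const w)).norm
    have hUU : ∀ (n : ℕ) ω, U n ω - U' n ω = ((n : ℂ) + 1)⁻¹ * (Z 0 ω - w) := fun n ω => by
      simp only [hU, hU']; ring
    refine tendsto_integral_filter_of_dominated_convergence
      (fun ω => B * (C * (δ / 2) ^ (-b)) * ‖Z 0 ω - w‖)
      (.of_forall fun n => ((hDm n).indicator (hbad n).compl).aestronglyMeasurable) ?_
      (hZw.const_mul _) ?_
    · filter_upwards [eventually_gt_atTop 0] with n hn
      filter_upwards [hs.sampleMean_pos hn, h.pos] with ω h1 h2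
      have hC := hg.nonneg_C
      by_cases hω : L (S n ω) < δ
      · rw [Set.indicator_of_notMem (by simpa using hω), norm_zero]
        positivity
      · rw [Set.indicator_of_mem (by simpa using hω)]
        rw [not_lt] at hω
        have h3 := half_le_map_update_mean hn h1 h2
        have h4 := half_le_map_update_mean hn h1 hLw
        have h5 := hg.norm_sub_le (half_pos hδ) (w := U n ω) (w' := U' n ω)
          (le_trans (by linarith) h3) (le_trans (by linarith) h4)
        have hn1 : 0 < ‖(n : ℂ) + 1‖ := norm_pos_iff.2 (by exact_mod_cast n.succ_ne_zero)
        rw [hUU, norm_mul, norm_inv] at h5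
        simp only [hD, norm_mul]
        calc ‖(n : ℂ) + 1‖ * (‖κ (Z 0 ω)‖ * ‖g (U n ω) - g (U' n ω)‖)
            ≤ ‖(n : ℂ) + 1‖ * (B * (C * (δ / 2) ^ (-b) * (‖(n : ℂ) + 1‖⁻¹ * ‖Z 0 ω - w‖))) := by
              gcongr; exact hB _
          _ = _ := by field_simp
    · have hL : ∀ᵐ ω ∂P, Tendsto (fun n => S n ω) atTop (𝓝 w) := by
        have := hs.ae_tendsto_sampleMean
        rwa [hsw] at this
      filter_upwards [hL, h.ae_tendsto_sampleMean, h.ae_tendsto_update_mean w] with ω h1 h2 h3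
      rw [← hw] at h2 h3
      have h2' : Tendsto (fun n => U n ω) atTop (𝓝 w) :=
        ((tendsto_add_atTop_iff_nat 1).2 h2).congr fun n => sampleMean_succ _ _ _
      have h4 := (tendsto_mul_sub_of_hasStrictDerivAt (hg.hasStrictDerivAt w hLw) h2' h3
        (fun n => hUU n ω)).const_mul (κ (Z 0 ω))
      refine h4.congr' ?_
      filter_upwards [((L.continuous.tendsto w).comp h1).eventually_const_lt hδw] with n hn
      rw [Set.indicator_of_mem (by simpa using hn.le)]
      simp only [hD]
      ring
  -- Where `L (S n) < δ`, the pointwise bound on `g` is enough, since the tail integral is `o(1/n)`.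
  · have ht := (htail a hg.nonneg_a).const_mul (2 * (B * (2 * (C * 2 ^ a))))
    rw [mul_zero] at ht
    refine squeeze_zero_norm' ?_ ht
    filter_upwards [eventually_gt_atTop 0, hs.eventually_integrable_rpow hg.nonneg_a] with n hn hi
    have hn1 : ‖(n : ℂ) + 1‖ ≤ 2 * n := by
      have e : ‖(n : ℂ) + 1‖ = (n : ℝ) + 1 := by
        rw [show (n : ℂ) + 1 = ((n + 1 : ℕ) : ℂ) by push_cast; rfl, Complex.norm_natCast]
        push_cast; rfl
      have : (1 : ℝ) ≤ n := by exact_mod_cast hn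
      rw [e]; linarith
    rw [integral_indicator (hbad n)]
    refine (norm_integral_le_of_norm_le (g := fun ω => 2 * n * (B * (2 * (C * 2 ^ a))) *
      L (S n ω) ^ (-a)) (hi.const_mul _).integrableOn (ae_restrict_of_ae ?_)).trans_eq ?_
    · filter_upwards [hcrude n hn] with ω hω
      simp only [hD, norm_mul]
      have h5 := (norm_sub_le (g (U n ω)) (g (U' n ω))).trans (add_le_add hω.1 hω.2)
      calc ‖(n : ℂ) + 1‖ * (‖κ (Z 0 ω)‖ * ‖g (U n ω) - g (U' n ω)‖)
          ≤ 2 * n * (B * (C * (2 ^ a * L (S n ω) ^ (-a)) + C * (2 ^ a * L (S n ω) ^ (-a)))) := by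
            gcongr; exact hB _
        _ = _ := by ring
    · rw [integral_const_mul]
      ring

/-- A lower bound for the asymptotic variance, by projection on sums of bounded functions
of the variables. -/
theorem eventually_lt_nat_mul_complexVar (h : IsPositiveIID L Z β P)
    (hg : IsControlled L g g' C a b) {k : ℂ → ℂ} (hk : Measurable k) {B : ℝ}
    (hB : ∀ z, ‖k z‖ ≤ B) (hk0 : ∫ ω, k (Z 0 ω) ∂P = 0) {w : ℂ} (hw : w = ∫ ω, Z 0 ω ∂P)
    {r : ℝ} (hr : r < ‖g' w‖ ^ 2 * (2 * (∫ ω, (starRingEnd ℂ) (k (Z 0 ω)) * (Z 0 ω - w) ∂P).re -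
      ∫ ω, ‖k (Z 0 ω)‖ ^ 2 ∂P)) :
    ∀ᶠ n : ℕ in atTop, r < n * complexVar (fun ω => g (sampleMean Z n ω)) P := by
  have hZ0 := h.measurable 0
  set c := g' w with hc
  have hconj : Measurable fun z => (starRingEnd ℂ) (k z) := by fun_prop
  have hlim := h.tendsto_nat_mul_integral_mul hg hconj (B := B) (fun z => by simpa using hB z)
    (by rw [integral_conj, hk0, map_zero]) hw
  have hlim2 := ((Complex.continuous_re.tendsto _).comp
    (hlim.const_mul ((starRingEnd ℂ) c))).const_mul 2 |>.sub_const
      (‖c‖ ^ 2 * ∫ ω, ‖k (Z 0 ω)‖ ^ 2 ∂P)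
  have hval : 2 * ((starRingEnd ℂ) c * ∫ ω, (starRingEnd ℂ) (k (Z 0 ω)) *
      (c * (Z 0 ω - w)) ∂P).re = ‖c‖ ^ 2 *
        (2 * (∫ ω, (starRingEnd ℂ) (k (Z 0 ω)) * (Z 0 ω - w) ∂P).re) := by
    simp_rw [mul_left_comm _ c]
    rw [integral_const_mul, ← mul_assoc, Complex.conj_mul']
    rw [← Complex.ofReal_pow, Complex.re_ofReal_mul]
    ring
  rw [hval, ← mul_sub] at hlim2
  filter_upwards [hlim2.eventually_const_lt hr, eventually_gt_atTop 0, h.eventually_memLp hg]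
    with n hn hn0 hgn
  refine hn.trans_le ?_
  have hn' : (0 : ℝ) < n := by exact_mod_cast hn0
  have hnc : (n : ℂ) ≠ 0 := by exact_mod_cast hn0.ne'
  have hkid : ∀ j, IdentDistrib (fun ω => k (Z j ω)) (fun ω => k (Z 0 ω)) P P :=
    fun j => (h.ident j).comp hk
  have hkind : iIndepFun (fun j ω => k (Z j ω)) P := h.indep.comp (fun _ => k) fun _ => hk
  have hkL : ∀ j, MemLp (fun ω => k (Z j ω)) 2 P := fun j =>
    MemLp.of_bound (hk.comp (h.measurable j)).aestronglyMeasurable B (.of_forall fun _ => hB _)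
  -- The test variable is `c K`, the linearisation of `g (W_n)` with `Z_j - w` replaced by the
  -- bounded `k (Z_j)`.
  set K := sampleMean (fun j ω => k (Z j ω)) n with hK
  have hKL : MemLp K 2 P := memLp_sampleMean hkid (hkL 0) n
  have hK0 : ∫ ω, K ω ∂P = 0 :=
    (integral_sampleMean hkid ((hkL 0).integrable one_le_two) hn0).trans hk0
  have hle := le_complexVar hgn (hKL.const_mul c) (by rw [integral_const_mul, hK0, mul_zero])
  have hsq : (n : ℝ) * ∫ ω, ‖c * K ω‖ ^ 2 ∂P = ‖c‖ ^ 2 * ∫ ω, ‖k (Z 0 ω)‖ ^ 2 ∂P := by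
    have := nat_mul_integral_norm_sampleMean_sub_sq hkid hkind (hkL 0) hn0
    unfold complexVar at this
    simp only [hk0, sub_zero] at this
    simp only [norm_mul, mul_pow, integral_const_mul]
    rw [← this]; ring
  have hcross : ∫ ω, (starRingEnd ℂ) (c * K ω) * g (sampleMean Z n ω) ∂P =
      (starRingEnd ℂ) c * ∫ ω, (starRingEnd ℂ) (k (Z 0 ω)) * g (sampleMean Z n ω) ∂P := by
    have e1 : ∀ ω, (starRingEnd ℂ) (c * K ω) * g (sampleMean Z n ω) = (starRingEnd ℂ) c *
        ((n : ℂ)⁻¹ * ∑ j ∈ Finset.range n, (starRingEnd ℂ) (k (Z j ω)) * g (sampleMean Z n ω)) := by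
      intro ω
      simp only [hK, sampleMean, map_mul, map_inv₀, map_natCast, map_sum, ← Finset.sum_mul]
      ring
    simp_rw [e1]
    rw [integral_const_mul, integral_const_mul, integral_finsetSum]
    · rw [Finset.sum_congr rfl fun j hj =>
        h.integral_mul_sampleMean_eq hg.measurable hconj (Finset.mem_range.1 hj)]
      simp [hnc]
    · intro j _
      exact (hkL j).star.integrable_mul hgn
  rw [hcross] at hle
  have := mul_le_mul_of_nonneg_left hle hn'.le
  rw [mul_sub, hsq] at this
  refine le_trans (le_of_eq ?_) this
  congr 1
  simp only [Function.comp]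
  rw [mul_left_comm _ (n : ℂ), ← Complex.ofReal_natCast, Complex.re_ofReal_mul]
  ring

/-- The projection bound is applied to centred truncations `t_N (Z 0) - μ`. As `conj (t_N z) z =
‖t_N z‖²`, it is at least `‖g' w‖² (E N - 2 m²)` with `m = E‖Z 0‖`, and `E N → ∞` by monotone
convergence. -/
theorem tendsto_nat_mul_complexVar_atTop (h : IsPositiveIID L Z β P)
    (hg : IsControlled L g g' C a b) (hg0 : g' (∫ ω, Z 0 ω ∂P) ≠ 0) (hZ2 : ¬ MemLp (Z 0) 2 P) :
    Tendsto (fun n : ℕ => (n : ℝ) * complexVar (fun ω => g (sampleMean Z n ω)) P) atTop atTop := by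
  set w := ∫ ω, Z 0 ω ∂P with hw
  have hZ0 := h.measurable 0
  set t : ℕ → ℂ → ℂ := fun N => {z : ℂ | ‖z‖ ≤ N}.indicator id with ht
  have htm : ∀ N, Measurable (t N) := fun N =>
    measurable_id.indicator (measurableSet_le measurable_norm measurable_const)
  have htb : ∀ N z, ‖t N z‖ ≤ N := by
    intro N z
    by_cases hz : ‖z‖ ≤ N
    · simp only [ht]; rw [Set.indicator_of_mem (by exact hz)]; exact hz
    · simp only [ht]; rw [Set.indicator_of_notMem (by exact hz)]; simp
  have htle : ∀ N z, ‖t N z‖ ≤ ‖z‖ := fun N z => norm_indicator_le_norm_self _ _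
  have htL : ∀ N p, MemLp (fun ω => t N (Z 0 ω)) p P := fun N p =>
    MemLp.of_bound ((htm N).comp hZ0).aestronglyMeasurable N (.of_forall fun _ => htb _ _)
  set E : ℕ → ℝ := fun N => ∫ ω, ‖t N (Z 0 ω)‖ ^ 2 ∂P with hE
  have hsqi : ∀ N, Integrable (fun ω => ‖t N (Z 0 ω)‖ ^ 2) P := fun N =>
    (memLp_two_iff_integrable_sq_norm (htL N 2).1).1 (htL N 2)
  have hunb : Tendsto E atTop atTop := by
    have hmono : ∀ ω, Monotone fun N : ℕ => ‖t N (Z 0 ω)‖ ^ 2 := by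
      intro ω M N hMN
      have : ‖t M (Z 0 ω)‖ ≤ ‖t N (Z 0 ω)‖ := by
        by_cases hz : ‖Z 0 ω‖ ≤ M
        · have hz' : ‖Z 0 ω‖ ≤ N := hz.trans (by exact_mod_cast hMN)
          simp only [ht]
          rw [Set.indicator_of_mem (by exact hz), Set.indicator_of_mem (by exact hz')]
        · simp only [ht]
          rw [Set.indicator_of_notMem (by exact hz)]
          simp
      simp only
      gcongr
    have hlim : ∀ ω, Tendsto (fun N : ℕ => ‖t N (Z 0 ω)‖ ^ 2) atTop (𝓝 (‖Z 0 ω‖ ^ 2)) := by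
      intro ω
      refine tendsto_const_nhds.congr' ?_
      filter_upwards [(tendsto_natCast_atTop_atTop (R := ℝ)).eventually_ge_atTop ‖Z 0 ω‖] with N hN
      simp only [ht]
      rw [Set.indicator_of_mem (by exact hN)]
      rfl
    have hl := lintegral_tendsto_of_tendsto_of_monotone (μ := P)
      (f := fun (N : ℕ) ω => ENNReal.ofReal (‖t N (Z 0 ω)‖ ^ 2))
      (F := fun ω => ENNReal.ofReal (‖Z 0 ω‖ ^ 2)) (fun N => (hsqi N).aemeasurable.ennreal_ofReal)
      (.of_forall fun ω M N hMN => ENNReal.ofReal_le_ofReal (hmono ω hMN))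
      (.of_forall fun ω => ENNReal.tendsto_ofReal (hlim ω))
    have htop : ∫⁻ ω, ENNReal.ofReal (‖Z 0 ω‖ ^ 2) ∂P = ⊤ := by
      by_contra hne
      refine hZ2 ((memLp_two_iff_integrable_sq_norm hZ0.aestronglyMeasurable).2 ⟨?_, ?_⟩)
      · exact (hZ0.norm.pow_const 2).aestronglyMeasurable
      · rw [hasFiniteIntegral_iff_ofReal (.of_forall fun _ => sq_nonneg _)]
        exact lt_top_iff_ne_top.2 hne
    rw [htop] at hl
    refine ENNReal.tendsto_ofReal_nhds_top.1 (hl.congr fun N => ?_)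
    exact (ofReal_integral_eq_lintegral_ofReal (hsqi N) (.of_forall fun _ => sq_nonneg _)).symm
  rw [tendsto_atTop]
  intro r
  set m := ∫ ω, ‖Z 0 ω‖ ∂P
  have hc : 0 < ‖g' w‖ ^ 2 := by positivity
  obtain ⟨N, hN⟩ := (hunb.eventually_gt_atTop (r / ‖g' w‖ ^ 2 + 2 * m ^ 2)).exists
  set μ := ∫ ω, t N (Z 0 ω) ∂P with hμ
  have hti := (htL N 2).integrable one_le_two
  have := h.eventually_lt_nat_mul_complexVar hg (k := fun z => t N z - μ) ((htm N).sub_const _)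
    (B := N + ‖μ‖) (fun z => (norm_sub_le _ _).trans (by gcongr; exact htb _ _))
    (by rw [integral_sub hti (integrable_const _)]; simp [hμ]) hw (r := r) ?_
  · exact this.mono fun n hn => hn.le
  have hvar : ∫ ω, ‖t N (Z 0 ω) - μ‖ ^ 2 ∂P ≤ E N := by
    have := complexVar_eq_sub (htL N 2)
    unfold complexVar at this
    rw [this]
    exact sub_le_self _ (sq_nonneg _)
  have hμle : ‖μ‖ ≤ m := by
    refine (norm_integral_le_integral_norm _).trans (integral_mono hti.norm h.integrable.norm ?_)
    exact fun ω => htle _ _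
  have hwle : ‖w‖ ≤ m := norm_integral_le_integral_norm _
  have hconj : ∀ z, (starRingEnd ℂ) (t N z) * z = ((‖t N z‖ ^ 2 : ℝ) : ℂ) := by
    intro z
    by_cases hz : ‖z‖ ≤ N
    · simp only [ht]; rw [Set.indicator_of_mem (by exact hz), id, Complex.conj_mul']; norm_cast
    · simp only [ht]; rw [Set.indicator_of_notMem (by exact hz)]; simp
  have hcov : ∫ ω, (starRingEnd ℂ) (t N (Z 0 ω) - μ) * (Z 0 ω - w) ∂P =
      (E N : ℂ) - (starRingEnd ℂ) μ * w := by
    have e1 : ∀ ω, (starRingEnd ℂ) (t N (Z 0 ω) - μ) * (Z 0 ω - w) =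
        ((‖t N (Z 0 ω)‖ ^ 2 : ℝ) : ℂ) - (starRingEnd ℂ) (t N (Z 0 ω)) * w -
          (starRingEnd ℂ) μ * (Z 0 ω - w) := by
      intro ω
      rw [← hconj, map_sub]; ring
    have i1 : Integrable (fun ω => ((‖t N (Z 0 ω)‖ ^ 2 : ℝ) : ℂ)) P := (hsqi N).ofReal
    have i2 : Integrable (fun ω => (starRingEnd ℂ) (t N (Z 0 ω)) * w) P :=
      ((htL N 2).star.integrable one_le_two).mul_const w
    have i3 : Integrable (fun ω => (starRingEnd ℂ) μ * (Z 0 ω - w)) P :=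
      (h.integrable.sub (integrable_const w)).const_mul _
    have i12 : Integrable (fun ω => ((‖t N (Z 0 ω)‖ ^ 2 : ℝ) : ℂ) -
      (starRingEnd ℂ) (t N (Z 0 ω)) * w) P := i1.sub i2
    simp_rw [e1]
    rw [integral_sub i12 i3, integral_sub i1 i2, integral_complex_ofReal, integral_mul_const,
      integral_conj, integral_const_mul, integral_sub h.integrable (integrable_const w)]
    simp [← hw, hE, hμ]
  rw [hcov]
  have hre : -(m * m) ≤ -((starRingEnd ℂ) μ * w).re := by
    have h1 := Complex.re_le_norm ((starRingEnd ℂ) μ * w)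
    rw [norm_mul, Complex.norm_conj] at h1
    have : ‖μ‖ * ‖w‖ ≤ m * m := by gcongr
    linarith
  rw [Complex.sub_re, Complex.ofReal_re, ← div_lt_iff₀' hc]
  nlinarith

end IsPositiveIID

end PowerMean

end

noncomputable section

namespace PowerMean

/-! ### Complex powers on half-planes and sectors -/

section Analytic

open Real

/-- The real-linear functional `w ↦ Re (exp (-i p π / 2) w)`. -/
def halfPlaneCLM (p : ℝ) : ℂ →L[ℝ] ℝ :=
  cos (p * (π / 2)) • Complex.reCLM + sin (p * (π / 2)) • Complex.imCLM

/-- The real-linear functional `w ↦ Im (exp (-i p π) w)`. -/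
def sectorCLM (p : ℝ) : ℂ →L[ℝ] ℝ :=
  cos (p * π) • Complex.imCLM - sin (p * π) • Complex.reCLM

theorem halfPlaneCLM_apply (p : ℝ) (w : ℂ) :
    halfPlaneCLM p w = ‖w‖ * cos (w.arg - p * (π / 2)) := by
  simp only [halfPlaneCLM, add_apply, FunLike.coe_smul, Pi.smul_apply,
    Complex.reCLM_apply, Complex.imCLM_apply, smul_eq_mul]
  rw [← Complex.norm_mul_cos_arg, ← Complex.norm_mul_sin_arg, cos_sub]
  ring

theorem sectorCLM_apply (p : ℝ) (w : ℂ) :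
    sectorCLM p w = ‖w‖ * sin (w.arg - p * π) := by
  simp only [sectorCLM, sub_apply, FunLike.coe_smul, Pi.smul_apply,
    Complex.reCLM_apply, Complex.imCLM_apply, smul_eq_mul]
  rw [← Complex.norm_mul_cos_arg, ← Complex.norm_mul_sin_arg, sin_sub]
  ring

theorem halfPlaneCLM_le_norm (p : ℝ) (w : ℂ) : halfPlaneCLM p w ≤ ‖w‖ := by
  rw [halfPlaneCLM_apply]
  exact mul_le_of_le_one_right (norm_nonneg _) (cos_le_one _)

variable {p : ℝ}

/-- On the cut, the angle to the axis of the half-plane is `π - p π / 2`, which lies in `(π, 3π/2]`,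
where the cosine is not positive. -/
theorem mem_slitPlane_of_halfPlaneCLM_pos (hp : -1 ≤ p) (hp0 : p < 0) {w : ℂ}
    (hw : 0 < halfPlaneCLM p w) : w ∈ Complex.slitPlane := by
  rw [Complex.mem_slitPlane_iff_arg]
  refine ⟨fun h => ?_, fun h => by simp [h] at hw⟩
  rw [halfPlaneCLM_apply, h] at hw
  have h1 : cos (π - p * (π / 2)) ≤ 0 := by
    apply cos_nonpos_of_pi_div_two_le_of_le <;> nlinarith [pi_pos]
  exact absurd hw (not_lt.2 (mul_nonpos_of_nonneg_of_nonpos (norm_nonneg _) h1))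

/-- The exponents `1/p` and `1/p - 1` are negative and `L w ≤ ‖w‖`. The constant `-1/p` is the one
of the derivative; it serves the function too because `|p| ≤ 1`. -/
theorem isControlled_cpow_inv (hp : -1 ≤ p) (hp0 : p < 0) :
    IsControlled (halfPlaneCLM p) (fun w => w ^ ((p⁻¹ : ℝ) : ℂ))
      (fun w => ((p⁻¹ : ℝ) : ℂ) * w ^ (((p⁻¹ - 1 : ℝ)) : ℂ)) (-p⁻¹) (-p⁻¹) (1 - p⁻¹) where
  measurable := by fun_prop
  nonneg_C := by have := inv_lt_zero.2 hp0; linarith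
  nonneg_a := by have := inv_lt_zero.2 hp0; linarith
  nonneg_b := by have := inv_lt_zero.2 hp0; linarith
  norm_le w hw := by
    have h1 : 1 ≤ -p⁻¹ := by
      rw [← inv_neg]; exact (one_le_inv₀ (by linarith)).2 (by linarith)
    rw [Complex.norm_cpow_real, neg_neg]
    refine (rpow_le_rpow_of_nonpos hw (halfPlaneCLM_le_norm p w) (by linarith)).trans ?_
    exact le_mul_of_one_le_left (rpow_nonneg hw.le _) h1
  hasStrictDerivAt w hw := by
    have := Complex.hasStrictDerivAt_cpow_const (c := ((p⁻¹ : ℝ) : ℂ))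
      (mem_slitPlane_of_halfPlaneCLM_pos hp hp0 hw)
    convert this using 2
    push_cast; rfl
  norm_deriv_le w hw := by
    have h1 := inv_lt_zero.2 hp0
    rw [norm_mul, Complex.norm_cpow_real, Complex.norm_real, norm_of_nonpos h1.le, neg_sub]
    refine mul_le_mul_of_nonneg_left ?_ (by linarith)
    exact rpow_le_rpow_of_nonpos hw (halfPlaneCLM_le_norm p w) (by linarith)

theorem arg_mem_Icc_of_im_nonneg {v : ℂ} (hv : 0 ≤ v.im) : v.arg ∈ Set.Icc 0 π :=
  ⟨Complex.arg_nonneg_iff.2 hv, Complex.arg_le_pi v⟩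

theorem arg_mem_Ioo_of_im_pos {v : ℂ} (hv : 0 < v.im) : v.arg ∈ Set.Ioo 0 π := by
  refine ⟨lt_of_le_of_ne (Complex.arg_nonneg_iff.2 hv.le) fun h => ?_,
    Complex.arg_lt_pi_iff.2 (Or.inr hv.ne')⟩
  exact hv.ne (Complex.arg_eq_zero_iff.1 h.symm).2.symm

theorem map_cpow (ℓ : ℂ →L[ℝ] ℝ) (v : ℂ) : ℓ (v ^ (p : ℂ)) =
    ‖v‖ ^ p * (cos (v.arg * p) * ℓ 1 + sin (v.arg * p) * ℓ Complex.I) := by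
  have : v ^ (p : ℂ) = (‖v‖ ^ p) • (cos (v.arg * p) • (1 : ℂ) + sin (v.arg * p) • Complex.I) := by
    rw [Complex.cpow_ofReal]
    simp [mul_add]
  rw [this, map_smul, map_add, map_smul, map_smul]
  simp

theorem halfPlaneCLM_cpow (p : ℝ) (v : ℂ) :
    halfPlaneCLM p (v ^ (p : ℂ)) = ‖v‖ ^ p * cos (p * (v.arg - π / 2)) := by
  rw [map_cpow, mul_sub, cos_sub]
  simp [halfPlaneCLM]
  ring_nf
  simp

theorem sectorCLM_cpow (p : ℝ) (v : ℂ) :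
    sectorCLM p (v ^ (p : ℂ)) = ‖v‖ ^ p * sin (p * (v.arg - π)) := by
  rw [map_cpow, mul_sub, sin_sub]
  simp [sectorCLM]
  ring_nf
  simp

/-- The argument of `v` is within `π/2` of `π/2`. The bound is informative for `p > -1` only: its
constant vanishes at `p = -1`. -/
theorem le_halfPlaneCLM_cpow (hp : -1 ≤ p) (hp0 : p < 0) {v : ℂ} (hv : 0 ≤ v.im) :
    cos (p * (π / 2)) * ‖v‖ ^ p ≤ halfPlaneCLM p (v ^ (p : ℂ)) := by
  obtain ⟨h1, h2⟩ := arg_mem_Icc_of_im_nonneg hv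
  rw [halfPlaneCLM_cpow, mul_comm]
  refine mul_le_mul_of_nonneg_left ?_ (by positivity)
  rw [← cos_abs (p * (π / 2)), ← cos_abs (p * (v.arg - π / 2))]
  have h3 : |v.arg - π / 2| ≤ π / 2 := abs_le.2 ⟨by linarith, by linarith⟩
  have hp1 : |p| ≤ 1 := abs_le.2 ⟨hp, by linarith⟩
  refine cos_le_cos_of_nonneg_of_le_pi (abs_nonneg _) ?_ ?_
  · rw [abs_mul, abs_of_pos (by positivity : 0 < π / 2)]
    nlinarith [pi_pos]
  · rw [abs_mul, abs_mul, abs_of_pos (by positivity : 0 < π / 2)]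
    gcongr

/-- A version that survives at `p = -1`: contracting the angle by `|p| ≤ 1` increases its cosine,
and `cos (arg v - π/2) = Im v / ‖v‖`. -/
theorem im_mul_le_halfPlaneCLM_cpow (hp : -1 ≤ p) (hp0 : p < 0) {v : ℂ} (hv : 0 < v.im) :
    v.im * ‖v‖ ^ (p - 1) ≤ halfPlaneCLM p (v ^ (p : ℂ)) := by
  obtain ⟨h1, h2⟩ := arg_mem_Icc_of_im_nonneg hv.le
  have hv0 : 0 < ‖v‖ := norm_pos_iff.2 fun h => by simp [h] at hv
  have h3 : |v.arg - π / 2| ≤ π / 2 := abs_le.2 ⟨by linarith, by linarith⟩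
  have hp1 : |p| ≤ 1 := abs_le.2 ⟨hp, by linarith⟩
  have h4 : cos (v.arg - π / 2) ≤ cos (p * (v.arg - π / 2)) := by
    rw [← cos_abs (v.arg - π / 2), ← cos_abs (p * (v.arg - π / 2))]
    refine cos_le_cos_of_nonneg_of_le_pi (abs_nonneg _) (by linarith [pi_pos]) ?_
    rw [abs_mul]
    exact mul_le_of_le_one_left (abs_nonneg _) hp1
  rw [halfPlaneCLM_cpow, rpow_sub_one hv0.ne']
  rw [cos_sub_pi_div_two, Complex.sin_arg] at h4
  calc v.im * (‖v‖ ^ p / ‖v‖) = ‖v‖ ^ p * (v.im / ‖v‖) := by ring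
    _ ≤ _ := by gcongr

theorem im_cpow_nonpos (hp : -1 ≤ p) (hp0 : p < 0) {v : ℂ} (hv : 0 ≤ v.im) :
    (v ^ (p : ℂ)).im ≤ 0 := by
  obtain ⟨h1, h2⟩ := arg_mem_Icc_of_im_nonneg hv
  rw [Complex.cpow_ofReal_im]
  refine mul_nonpos_of_nonneg_of_nonpos (by positivity) (sin_nonpos_of_nonpos_of_neg_pi_le ?_ ?_)
  · nlinarith
  · nlinarith [pi_pos]

theorem im_cpow_neg (hp : -1 ≤ p) (hp0 : p < 0) {v : ℂ} (hv : 0 < v.im) :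
    (v ^ (p : ℂ)).im < 0 := by
  obtain ⟨h1, h2⟩ := arg_mem_Ioo_of_im_pos hv
  have hv0 : 0 < ‖v‖ := norm_pos_iff.2 fun h => by simp [h] at hv
  rw [Complex.cpow_ofReal_im]
  refine mul_neg_of_pos_of_neg (by positivity) (sin_neg_of_neg_of_neg_pi_lt ?_ ?_)
  · nlinarith
  · nlinarith [pi_pos]

theorem sectorCLM_cpow_nonneg (hp : -1 ≤ p) (hp0 : p < 0) {v : ℂ} (hv : 0 ≤ v.im) :
    0 ≤ sectorCLM p (v ^ (p : ℂ)) := by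
  obtain ⟨h1, h2⟩ := arg_mem_Icc_of_im_nonneg hv
  rw [sectorCLM_cpow]
  refine mul_nonneg (by positivity) (sin_nonneg_of_nonneg_of_le_pi ?_ ?_)
  · nlinarith
  · nlinarith [pi_pos]

theorem sectorCLM_cpow_pos (hp : -1 ≤ p) (hp0 : p < 0) {v : ℂ} (hv : 0 < v.im) :
    0 < sectorCLM p (v ^ (p : ℂ)) := by
  obtain ⟨h1, h2⟩ := arg_mem_Ioo_of_im_pos hv
  have hv0 : 0 < ‖v‖ := norm_pos_iff.2 fun h => by simp [h] at hv
  rw [sectorCLM_cpow]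
  refine mul_pos (by positivity) (sin_pos_of_pos_of_lt_pi ?_ ?_)
  · nlinarith
  · nlinarith [pi_pos]

/-- The half-plane `{halfPlaneCLM p > 0}` and two linear inequalities cut out the sector
`arg w ∈ [p π, 0]`. -/
theorem arg_mem_Icc_of_sector (hp : -1 ≤ p) (hp0 : p < 0) {w : ℂ} (hw : 0 < halfPlaneCLM p w)
    (him : w.im ≤ 0) (hsec : 0 ≤ sectorCLM p w) : w.arg ∈ Set.Icc (p * π) 0 := by
  have hsl := mem_slitPlane_of_halfPlaneCLM_pos hp hp0 hw
  obtain ⟨hpi, hw0⟩ := Complex.mem_slitPlane_iff_arg.1 hsl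
  have hnorm : 0 < ‖w‖ := norm_pos_iff.2 hw0
  obtain ⟨h1, h2⟩ := Complex.arg_mem_Ioc w
  have h3 : w.arg ≤ 0 := by
    by_contra! h
    have h4 := mul_pos hnorm (sin_pos_of_pos_of_lt_pi h (lt_of_le_of_ne h2 hpi))
    rw [Complex.norm_mul_sin_arg] at h4
    linarith
  refine ⟨?_, h3⟩
  by_contra! h
  rw [sectorCLM_apply] at hsec
  have h5 : sin (w.arg - p * π) < 0 := by
    apply sin_neg_of_neg_of_neg_pi_lt
    · linarith
    · nlinarith [pi_pos]
  nlinarith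

theorem arg_mem_Ioo_of_sector (hp : -1 ≤ p) (hp0 : p < 0) {w : ℂ} (hw : 0 < halfPlaneCLM p w)
    (him : w.im < 0) (hsec : 0 < sectorCLM p w) : w.arg ∈ Set.Ioo (p * π) 0 := by
  obtain ⟨h1, h2⟩ := arg_mem_Icc_of_sector hp hp0 hw him.le hsec.le
  refine ⟨lt_of_le_of_ne h1 fun h => ?_, Complex.arg_neg_iff.2 him⟩
  rw [sectorCLM_apply, ← h] at hsec
  simp at hsec

theorem arg_cpow_inv (hp0 : p < 0) {w : ℂ} (hw : w ≠ 0) (h : w.arg ∈ Set.Icc (p * π) 0) :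
    (w ^ ((p⁻¹ : ℝ) : ℂ)).arg = w.arg * p⁻¹ := by
  rw [Complex.cpow_ofReal]
  have h1 : 0 < ‖w‖ ^ p⁻¹ := rpow_pos_of_pos (norm_pos_iff.2 hw) _
  rw [Complex.ofReal_cos, Complex.ofReal_sin]
  refine Complex.arg_mul_cos_add_sin_mul_I h1 ⟨?_, ?_⟩
  · have := mul_nonneg_of_nonpos_of_nonpos h.2 (inv_lt_zero.2 hp0).le
    linarith [pi_pos]
  · rw [← div_eq_mul_inv, div_le_iff_of_neg hp0, mul_comm]
    exact h.1

theorem cpow_inv_cpow (hp0 : p < 0) {w : ℂ} (h : w.arg ∈ Set.Icc (p * π) 0) :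
    (w ^ ((p⁻¹ : ℝ) : ℂ)) ^ (p : ℂ) = w := by
  have him : (Complex.log w * ((p⁻¹ : ℝ) : ℂ)).im = w.arg * p⁻¹ := by
    rw [Complex.im_mul_ofReal, Complex.log_im]
  have h0 := mul_nonneg_of_nonpos_of_nonpos h.2 (inv_lt_zero.2 hp0).le
  rw [← Complex.cpow_mul, ← Complex.ofReal_mul, inv_mul_cancel₀ hp0.ne, Complex.ofReal_one,
    Complex.cpow_one]
  · rw [him]; linarith [pi_pos]
  · rw [him, ← div_eq_mul_inv, div_le_iff_of_neg hp0, mul_comm]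
    exact h.1

theorem cpow_cpow_inv (hp0 : p < 0) {v : ℂ} (hv : 0 ≤ v.im) (h : -π < v.arg * p) :
    (v ^ (p : ℂ)) ^ ((p⁻¹ : ℝ) : ℂ) = v := by
  have him : (Complex.log v * (p : ℂ)).im = v.arg * p := by
    rw [Complex.im_mul_ofReal, Complex.log_im]
  rw [← Complex.cpow_mul, ← Complex.ofReal_mul, mul_inv_cancel₀ hp0.ne, Complex.ofReal_one,
    Complex.cpow_one]
  · rwa [him]
  · rw [him]
    have := mul_nonpos_of_nonneg_of_nonpos (Complex.arg_nonneg_iff.2 hv) hp0.le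
    linarith [pi_pos]

/-- Weighted AM-GM with weights `q/(1+q)` and `1/(1+q)`, then concavity of the sine on `[0, π]`. -/
theorem sin_rpow_mul_sin_le {q θ ψ : ℝ} (hq : 0 < q) (hθ : θ ∈ Set.Icc 0 π)
    (hψ : ψ ∈ Set.Icc 0 π) :
    sin θ ^ q * sin ψ ≤ sin ((q * θ + ψ) / (1 + q)) ^ (1 + q) := by
  have hs1 := sin_nonneg_of_mem_Icc hθ
  have hs2 := sin_nonneg_of_mem_Icc hψ
  have h1 : (0 : ℝ) < 1 + q := by linarith
  have e : q / (1 + q) + 1 / (1 + q) = 1 := by field_simp; ring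
  have hgm := geom_mean_le_arith_mean2_weighted (by positivity : 0 ≤ q / (1 + q))
    (by positivity : 0 ≤ 1 / (1 + q)) hs1 hs2 e
  have hconc := strictConcaveOn_sin_Icc.concaveOn.2 hθ hψ (by positivity : 0 ≤ q / (1 + q))
    (by positivity : 0 ≤ 1 / (1 + q)) e
  simp only [smul_eq_mul] at hconc
  have e2 : q / (1 + q) * θ + 1 / (1 + q) * ψ = (q * θ + ψ) / (1 + q) := by field_simp
  rw [e2] at hconc
  have h3 := rpow_le_rpow (by positivity) (hgm.trans hconc) h1.le
  refine le_trans (le_of_eq ?_) h3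
  rw [mul_rpow (by positivity) (by positivity), ← rpow_mul hs1, ← rpow_mul hs2]
  congr 1
  · congr 1; field_simp
  · rw [one_div, inv_mul_cancel₀ h1.ne', rpow_one]

/-- Supporting half-planes of the image of a half-plane under `z ↦ z ^ p`. -/
theorem im_cpow_mul_div_le (hp : -1 ≤ p) (hp0 : p < 0) {ζ z : ℂ} (hζ : 0 < ζ.im) (hz : 0 < z.im) :
    (ζ ^ (p : ℂ) * (z / z ^ (p : ℂ))).im ≤ ζ.im ^ p * z.im ^ (1 - p) := by
  obtain ⟨a1, a2⟩ := arg_mem_Ioo_of_im_pos hζ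
  obtain ⟨b1, b2⟩ := arg_mem_Ioo_of_im_pos hz
  have hz0 : z ≠ 0 := fun h => by simp [h] at hz
  have hζ0 : ζ ≠ 0 := fun h => by simp [h] at hζ
  have hzn := norm_pos_iff.2 hz0
  have hζn := norm_pos_iff.2 hζ0
  have e1 : z / z ^ (p : ℂ) = z ^ ((1 - p : ℝ) : ℂ) := by
    push_cast
    rw [Complex.cpow_sub _ _ hz0, Complex.cpow_one]
  have e2 : (ζ ^ (p : ℂ) * z ^ ((1 - p : ℝ) : ℂ)).im =
      ‖ζ‖ ^ p * ‖z‖ ^ (1 - p) * sin (p * ζ.arg + (1 - p) * z.arg) := by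
    rw [Complex.mul_im, Complex.cpow_ofReal_re, Complex.cpow_ofReal_im, Complex.cpow_ofReal_re,
      Complex.cpow_ofReal_im, sin_add, mul_comm p, mul_comm (1 - p)]
    ring
  rw [e1, e2]
  set θ := ζ.arg
  set φ := z.arg
  set ψ := p * θ + (1 - p) * φ with hψ
  have hsθ : 0 < sin θ := sin_pos_of_pos_of_lt_pi a1 a2
  have hsφ : 0 < sin φ := sin_pos_of_pos_of_lt_pi b1 b2
  have hrhs : ζ.im ^ p * z.im ^ (1 - p) =
      ‖ζ‖ ^ p * ‖z‖ ^ (1 - p) * (sin θ ^ p * sin φ ^ (1 - p)) := by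
    rw [← Complex.norm_mul_sin_arg ζ, ← Complex.norm_mul_sin_arg z,
      mul_rpow hζn.le hsθ.le, mul_rpow hzn.le hsφ.le]
    ring
  rw [hrhs]
  refine mul_le_mul_of_nonneg_left ?_ (by positivity)
  -- Only `-π < ψ < 2π` is known; a positive sine then forces `ψ` into `[0, π]`, where the concavity
  -- bound applies.
  rcases le_or_gt (sin ψ) 0 with h | h
  · exact h.trans (by positivity)
  · have hψlt : ψ < 2 * π := by nlinarith [pi_pos]
    have hψgt : -π < ψ := by nlinarith [pi_pos]
    have hψ0 : 0 ≤ ψ := by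
      by_contra! hneg
      exact absurd h (not_lt.2 (sin_neg_of_neg_of_neg_pi_lt hneg hψgt).le)
    have hψπ : ψ ≤ π := by
      by_contra! hgt
      have h5 := sin_pos_of_pos_of_lt_pi (x := ψ - π) (by linarith) (by linarith)
      rw [sin_sub_pi] at h5
      linarith
    -- With `q = -p` the weighted average of `θ` and `ψ` is exactly `φ`.
    have h6 := sin_rpow_mul_sin_le (q := -p) (by linarith) ⟨a1.le, a2.le⟩ ⟨hψ0, hψπ⟩
    have e3 : (-p * θ + ψ) / (1 + -p) = φ := by
      rw [hψ, div_eq_iff (by linarith : (1 : ℝ) + -p ≠ 0)]; ring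
    rw [e3, rpow_neg hsθ.le, ← sub_eq_add_neg, inv_mul_le_iff₀ (by positivity)] at h6
    exact h6

end Analytic

end PowerMean

end

noncomputable section

namespace PowerMean

/-! ### Range, inverse and derivative of the generator -/

section Generator

open Real

variable {p : ℝ} {α : ℂ}

/-- The parameters for which the generator is injective on its domain and convexity of its range
makes the quasi-arithmetic mean well-defined. -/
structure Admissible (p : ℝ) (α : ℂ) : Prop where
  neg_one_le : -1 ≤ p
  neg : p < 0
  im_nonneg : 0 ≤ α.im
  neg_one_lt_or : 0 < α.im ∨ -1 < p

/-- The inverse of the generator. -/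
def generatorInv (p : ℝ) (α : ℂ) (w : ℂ) : ℂ := w ^ ((p⁻¹ : ℝ) : ℂ) - α

theorem generatorInv_generator (h : Admissible p α) {z : ℂ} (hz : z ∈ domain α) :
    generatorInv p α (generator p α z) = z := by
  have him : (z + α).im = z.im + α.im := Complex.add_im _ _
  have hz0 := hz.1
  have ha := h.im_nonneg
  unfold generatorInv generator
  rw [cpow_cpow_inv h.neg (by linarith), add_sub_cancel_right]
  have hp := h.neg_one_le
  rcases h.neg_one_lt_or with hα | hp1
  · obtain ⟨h1, h2⟩ := arg_mem_Ioo_of_im_pos (v := z + α) (by linarith)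
    nlinarith [h.neg, pi_pos]
  · obtain ⟨h1, h2⟩ := arg_mem_Icc_of_im_nonneg (v := z + α) (by linarith)
    nlinarith [h.neg, pi_pos]

theorem invFunOn_generator (h : Admissible p α) {w : ℂ} (hw : generatorInv p α w ∈ domain α)
    (hgw : generator p α (generatorInv p α w) = w) :
    Function.invFunOn (generator p α) (domain α) w = generatorInv p α w := by
  have hinj : Set.InjOn (generator p α) (domain α) := fun x hx y hy hxy => by
    rw [← generatorInv_generator h hx, hxy, generatorInv_generator h hy]
  have := hinj.leftInvOn_invFunOn hw
  rwa [hgw] at this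

theorem im_ofReal_add (x : ℝ) (α : ℂ) : ((x : ℂ) + α).im = α.im := by simp

theorem halfPlaneCLM_generator_pos (h : Admissible p α) {x : ℝ} (hx : (x : ℂ) + α ≠ 0) :
    0 < halfPlaneCLM p (generator p α x) := by
  have hn : 0 < ‖(x : ℂ) + α‖ := norm_pos_iff.2 hx
  rcases h.neg_one_lt_or with hα | hp1
  · have := im_mul_le_halfPlaneCLM_cpow h.neg_one_le h.neg (v := x + α) (by simpa using hα)
    rw [im_ofReal_add] at this
    exact lt_of_lt_of_le (by positivity) this
  · have := le_halfPlaneCLM_cpow h.neg_one_le h.neg (v := x + α) (by simpa using h.im_nonneg)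
    refine lt_of_lt_of_le (mul_pos (cos_pos_of_mem_Ioo ⟨?_, ?_⟩) (by positivity)) this
    · nlinarith [pi_pos]
    · nlinarith [pi_pos, h.neg]

/-- The mean of the generator under a probability measure on the line lies in the range of
the generator. -/
theorem generatorInv_integral {Ω : Type*} [MeasurableSpace Ω] {ν : Measure Ω}
    [IsProbabilityMeasure ν] (h : Admissible p α) {ξ : Ω → ℝ}
    (hξ : ∀ᵐ ω ∂ν, (ξ ω : ℂ) + α ≠ 0) (hint : Integrable (fun ω => generator p α (ξ ω)) ν) :
    0 < halfPlaneCLM p (∫ ω, generator p α (ξ ω) ∂ν) ∧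
    generatorInv p α (∫ ω, generator p α (ξ ω) ∂ν) ∈ domain α ∧
    generator p α (generatorInv p α (∫ ω, generator p α (ξ ω) ∂ν)) =
      ∫ ω, generator p α (ξ ω) ∂ν := by
  set w := ∫ ω, generator p α (ξ ω) ∂ν with hw
  have hp := h.neg_one_le
  have hp0 := h.neg
  have hi : ∀ ω, 0 ≤ ((ξ ω : ℂ) + α).im := fun ω => by simpa using h.im_nonneg
  have hmap : ∀ ℓ : ℂ →L[ℝ] ℝ, ℓ w = ∫ ω, ℓ (generator p α (ξ ω)) ∂ν := fun ℓ =>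
    (ℓ.integral_comp_comm hint).symm
  have hL : 0 < halfPlaneCLM p w := by
    rw [hmap]
    exact integral_pos_of_ae_pos ((halfPlaneCLM p).integrable_comp hint)
      (hξ.mono fun ω hω => halfPlaneCLM_generator_pos h hω)
  have hw0 : w ≠ 0 := fun h0 => by rw [h0, map_zero] at hL; exact hL.false
  have him : w.im ≤ 0 := by
    have e : w.im = ∫ ω, (generator p α (ξ ω)).im ∂ν := hmap Complex.imCLM
    rw [e]
    exact integral_nonpos fun ω => im_cpow_nonpos hp hp0 (hi ω)
  have hsec : 0 ≤ sectorCLM p w := by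
    rw [hmap]
    exact integral_nonneg fun ω => sectorCLM_cpow_nonneg hp hp0 (hi ω)
  have harg := arg_mem_Icc_of_sector hp hp0 hL him hsec
  have hinv : (w ^ ((p⁻¹ : ℝ) : ℂ)) ^ (p : ℂ) = w := cpow_inv_cpow hp0 harg
  have hne : w ^ ((p⁻¹ : ℝ) : ℂ) ≠ 0 := by
    rw [Complex.cpow_ne_zero_iff]; exact Or.inl hw0
  refine ⟨hL, ⟨?_, ?_⟩, ?_⟩
  · unfold generatorInv
    rw [Complex.sub_im, sub_nonneg]
    have hzarg := arg_cpow_inv hp0 hw0 harg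
    rcases h.im_nonneg.eq_or_lt' with hα | hα
    · rw [hα, ← Complex.arg_nonneg_iff, hzarg]
      exact mul_nonneg_of_nonpos_of_nonpos harg.2 (inv_lt_zero.2 hp0).le
    · have hi' : ∀ ω, 0 < ((ξ ω : ℂ) + α).im := fun ω => by simpa using hα
      have him' : w.im < 0 := by
        have e : w.im = ∫ ω, (generator p α (ξ ω)).im ∂ν := hmap Complex.imCLM
        have := integral_pos_of_ae_pos (Complex.imCLM.integrable_comp hint).neg
          (.of_forall fun ω => neg_pos.2 (im_cpow_neg hp hp0 (hi' ω)))
        rw [integral_neg'] at this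
        rw [e]
        exact neg_pos.1 this
      have hsec' : 0 < sectorCLM p w := by
        rw [hmap]
        exact integral_pos_of_ae_pos ((sectorCLM p).integrable_comp hint)
          (.of_forall fun ω => sectorCLM_cpow_pos hp hp0 (hi' ω))
      have harg' := arg_mem_Ioo_of_sector hp hp0 hL him' hsec'
      set z := w ^ ((p⁻¹ : ℝ) : ℂ) with hz
      have hzim : 0 < z.im := by
        rw [← Complex.norm_mul_sin_arg, hzarg]
        refine mul_pos (norm_pos_iff.2 hne) (sin_pos_of_pos_of_lt_pi ?_ ?_)
        · exact mul_pos_of_neg_of_neg harg'.2 (inv_lt_zero.2 hp0)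
        · rw [← div_eq_mul_inv, div_lt_iff_of_neg hp0, mul_comm]
          exact harg'.1
      -- The supporting half-plane at `z` is a linear inequality satisfied by every value of the
      -- generator, hence by their mean `w = z ^ p`, at which the linear form equals `Im z`.
      -- Cancelling powers leaves `(Im z)^p ≤ (Im α)^p`, that is `Im z ≥ Im α` as `p < 0`.
      have hkey : z.im ≤ α.im ^ p * z.im ^ (1 - p) := by
        have e := hmap (Complex.imCLM ∘L (ContinuousLinearMap.mul ℝ ℂ (z / z ^ (p : ℂ))))
        simp only [ContinuousLinearMap.coe_comp, Function.comp, Complex.imCLM_apply,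
          ContinuousLinearMap.mul_apply'] at e
        have e2 : z / z ^ (p : ℂ) * w = z := by rw [hinv, div_mul_cancel₀ _ hw0]
        rw [e2] at e
        have hint' := (hint.const_mul (z / z ^ (p : ℂ))).im
        refine e.trans_le ((integral_mono hint' (integrable_const (α.im ^ p * z.im ^ (1 - p)))
          fun ω => ?_).trans_eq (by simp))
        have := im_cpow_mul_div_le hp hp0 (hi' ω) hzim
        rw [im_ofReal_add, mul_comm] at this
        exact this
      rw [rpow_sub hzim, rpow_one, ← mul_div_assoc, le_div_iff₀ (by positivity), mul_comm] at hkey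
      have h2 := le_of_mul_le_mul_right hkey hzim
      by_contra! hlt
      exact absurd h2 (not_le.2 (rpow_lt_rpow_of_neg hzim hlt hp0))
  · unfold generatorInv
    intro h0
    apply hne
    linear_combination h0
  · unfold generator generatorInv
    rw [sub_add_cancel, hinv]

/-- Where `z + α` is a negative real the principal power is discontinuous. Rotation by `-i` sends
the closed upper half-plane without `0` into the slit plane, and the rotated power agrees with the
generator on the whole domain. -/
theorem hasDerivWithinAt_generator {z : ℂ} (ha : 0 ≤ α.im) (hz : z ∈ domain α) :
    HasDerivWithinAt (generator p α) (Complex.I ^ (p : ℂ) *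
      (p * (-Complex.I * (z + α)) ^ ((p : ℂ) - 1) * -Complex.I)) (domain α) z := by
  have hrot : ∀ y ∈ domain α, generator p α y =
      Complex.I ^ (p : ℂ) * (-Complex.I * (y + α)) ^ (p : ℂ) := by
    intro y hy
    have hyim : 0 ≤ (y + α).im := by have := hy.1; rw [Complex.add_im]; linarith
    have hy0 : y + α ≠ 0 := fun h => hy.2 (eq_neg_of_add_eq_zero_left h)
    have hr0 : -Complex.I * (y + α) ≠ 0 := mul_ne_zero (by simp) hy0
    have harg : |(-Complex.I * (y + α)).arg| ≤ π / 2 :=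
      Complex.abs_arg_le_pi_div_two_iff.2 (by simpa using hyim)
    obtain ⟨h1, h2⟩ := abs_le.1 harg
    have hmul : y + α = Complex.I * (-Complex.I * (y + α)) := by
      linear_combination (y + α) * Complex.I_mul_I
    have hlog := Complex.log_mul Complex.I_ne_zero hr0 (by
      rw [Complex.arg_I]; constructor <;> linarith [pi_pos])
    unfold generator
    rw [Complex.cpow_def_of_ne_zero hy0, Complex.cpow_def_of_ne_zero Complex.I_ne_zero,
      Complex.cpow_def_of_ne_zero hr0, ← Complex.exp_add, ← add_mul, ← hlog, ← hmul]
  have hzim : 0 ≤ (z + α).im := by have := hz.1; rw [Complex.add_im]; linarith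
  have hz0 : z + α ≠ 0 := fun h => hz.2 (eq_neg_of_add_eq_zero_left h)
  have hsl : -Complex.I * (z + α) ∈ Complex.slitPlane := by
    rw [Complex.mem_slitPlane_iff]
    by_cases h0 : (z + α).im = 0
    · right
      intro h
      apply hz0
      apply Complex.ext
      · simp at h ⊢; linarith
      · exact h0
    · left
      have : 0 < (z + α).im := lt_of_le_of_ne hzim (Ne.symm h0)
      simpa using this
  have hd : HasDerivAt (fun y : ℂ => -Complex.I * (y + α)) (-Complex.I) z := by
    simpa using ((hasDerivAt_id z).add_const α).const_mul (-Complex.I)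
  exact ((hd.cpow_const hsl).const_mul _).hasDerivWithinAt.congr hrot (hrot z hz)

theorem uniqueDiffWithinAt_domain {z : ℂ} (hz : z ∈ domain α) :
    UniqueDiffWithinAt ℂ (domain α) z := by
  have hconv : Convex ℝ {y : ℂ | 0 ≤ y.im} :=
    convex_halfSpace_ge Complex.imLm.isLinear 0
  have hint : (interior {y : ℂ | 0 ≤ y.im}).Nonempty := by
    refine ⟨Complex.I, interior_mono (show {y : ℂ | 0 < y.im} ⊆ {y : ℂ | 0 ≤ y.im} from
      fun y hy => le_of_lt (show 0 < y.im from hy)) ?_⟩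
    rw [(isOpen_lt continuous_const Complex.continuous_im).interior_eq]
    simp
  have h1 := uniqueDiffWithinAt_convex_of_isRCLikeNormedField (𝕜 := ℂ) hconv hint
    (subset_closure hz.1)
  exact h1.inter (isOpen_compl_singleton.mem_nhds hz.2)

theorem norm_derivWithin_generator {z : ℂ} (ha : 0 ≤ α.im) (hz : z ∈ domain α) :
    ‖derivWithin (generator p α) (domain α) z‖ = |p| * ‖z + α‖ ^ (p - 1) := by
  rw [(hasDerivWithinAt_generator ha hz).derivWithin (uniqueDiffWithinAt_domain hz)]
  have : (p : ℂ) - 1 = ((p - 1 : ℝ) : ℂ) := by push_cast; rfl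
  rw [this]
  simp only [norm_mul, Complex.norm_cpow_real, norm_neg, Complex.norm_I, Complex.norm_real, one_rpow,
    one_mul, mul_one, norm_eq_abs]

/-- The inverse function rule in absolute value; it turns the constant of the delta method into the
asymptotic variance. -/
theorem sq_norm_deriv_cpow_inv (h : Admissible p α) {w : ℂ} (hw0 : w ≠ 0)
    (hw : generatorInv p α w ∈ domain α)
    (hgw : generator p α (generatorInv p α w) = w) (V : ℝ) :
    ‖((p⁻¹ : ℝ) : ℂ) * w ^ (((p⁻¹ - 1 : ℝ)) : ℂ)‖ ^ 2 * V =
      V / ‖derivWithin (generator p α) (domain α)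
        (Function.invFunOn (generator p α) (domain α) w)‖ ^ 2 := by
  rw [invFunOn_generator h hw hgw, norm_derivWithin_generator h.im_nonneg hw, generatorInv,
    sub_add_cancel, norm_mul, Complex.norm_cpow_real, Complex.norm_cpow_real, Complex.norm_real,
    ← rpow_mul (norm_nonneg w), norm_eq_abs, abs_inv]
  have hn : 0 < ‖w‖ := norm_pos_iff.2 hw0
  have hp := h.neg
  have e : p⁻¹ * (p - 1) = -(p⁻¹ - 1) := by
    rw [mul_sub, inv_mul_cancel₀ hp.ne]; ring
  have hpabs : 0 < |p| := abs_pos.2 hp.ne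
  rw [e, rpow_neg hn.le, div_eq_inv_mul, ← inv_pow, mul_inv, inv_inv]

end Generator

/-! ### From the random variables `X_j` to i.i.d. variables in the half-plane -/

section Sample

variable {Ω : Type*} [MeasurableSpace Ω] {P : Measure Ω}
  {X : ℕ → Ω → ℝ} {p : ℝ} {α : ℂ}

theorem measurable_generator : Measurable (generator p α) := by
  unfold generator; fun_prop

theorem ae_ofReal_add_ne_zero {ξ : Ω → ℝ} (hcont : ∀ x : ℝ, P {ω | ξ ω = x} = 0) :
    ∀ᵐ ω ∂P, (ξ ω : ℂ) + α ≠ 0 := by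
  have h : ∀ᵐ ω ∂P, ξ ω ≠ -α.re := by
    rw [ae_iff]; simpa using hcont (-α.re)
  filter_upwards [h] with ω hω h0
  apply hω
  have := congrArg Complex.re h0
  simp at this
  linarith

/-- A power lower bound, through which positive moments of `X` become negative moments of `L (f
(X))`. The exponent is `1 - p` when `Im α > 0` and `-p` when `p > -1`. -/
theorem exists_le_halfPlaneCLM_generator (h : Admissible p α) :
    ∃ κ r : ℝ, 0 < κ ∧ 0 < r ∧ ∀ x : ℝ, (x : ℂ) + α ≠ 0 →
      κ * ‖(x : ℂ) + α‖ ^ (-r) ≤ halfPlaneCLM p (generator p α x) := by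
  have hp := h.neg
  rcases h.neg_one_lt_or with hα | hp1
  · refine ⟨α.im, 1 - p, hα, by linarith, fun x _ => ?_⟩
    have := im_mul_le_halfPlaneCLM_cpow h.neg_one_le h.neg (v := x + α) (by simpa using hα)
    rwa [im_ofReal_add, ← neg_sub] at this
  · refine ⟨Real.cos (p * (Real.pi / 2)), -p, Real.cos_pos_of_mem_Ioo ⟨?_, ?_⟩, by linarith,
      fun x _ => ?_⟩
    · nlinarith [Real.pi_pos]
    · nlinarith [Real.pi_pos]
    · rw [neg_neg]
      exact le_halfPlaneCLM_cpow h.neg_one_le h.neg (v := x + α) (by simpa using h.im_nonneg)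

/-- A sample mean is the integral against the uniform measure on `n` points, so
`generatorInv_integral` covers it as well as the expectation. -/
theorem quasiMean_eq {Ω : Type*} {X : ℕ → Ω → ℝ} (h : Admissible p α) {n : ℕ} (hn : 0 < n) {ω : Ω}
    (hω : ∀ j, (X j ω : ℂ) + α ≠ 0) :
    quasiMean (generator p α) (domain α) X n ω =
      generatorInv p α (sampleMean (fun j ω => generator p α (X j ω)) n ω) := by
  have hnne : (n : ENNReal) ≠ 0 := by exact_mod_cast hn.ne'
  set ν : Measure (Fin n) := (n : ENNReal)⁻¹ • Measure.count with hν
  have : IsProbabilityMeasure ν := ⟨by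
    simp [hν, Measure.count_univ, ENNReal.inv_mul_cancel hnne (ENNReal.natCast_ne_top n)]⟩
  have hmean : ∫ j : Fin n, generator p α (X j ω) ∂ν =
      sampleMean (fun j ω => generator p α (X j ω)) n ω := by
    rw [hν, integral_smul_measure, integral_count, sampleMean,
      Finset.sum_range fun j => generator p α (X j ω)]
    simp
  have key := generatorInv_integral h (ν := ν) (ξ := fun j : Fin n => X j ω)
    (.of_forall fun j => hω j) (.of_finite)
  rw [hmean] at key
  exact invFunOn_generator h key.2.1 key.2.2

theorem quasiMean_ae_eq (h : Admissible p α) (hX_ident : ∀ j, IdentDistrib (X j) (X 0) P P)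
    (hX_cont : ∀ x : ℝ, P {ω | X 0 ω = x} = 0) {n : ℕ} (hn : 0 < n) :
    quasiMean (generator p α) (domain α) X n =ᵐ[P] fun ω =>
      sampleMean (fun j ω => generator p α (X j ω)) n ω ^ ((p⁻¹ : ℝ) : ℂ) - α := by
  have hm : MeasurableSet {x : ℝ | (x : ℂ) + α ≠ 0} :=
    (measurableSet_eq_fun (by fun_prop) measurable_const).compl
  filter_upwards [ae_forall_of_identDistrib hX_ident (p := fun x => (x : ℂ) + α ≠ 0) hm
    (ae_ofReal_add_ne_zero hX_cont)] with ω hω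
  exact quasiMean_eq h hn hω

variable [IsProbabilityMeasure P]

theorem exists_integrable_rpow_neg (h : Admissible p α) {ξ : Ω → ℝ} (hξ : Measurable ξ)
    (hξ0 : ∀ᵐ ω ∂P, (ξ ω : ℂ) + α ≠ 0) (hint : MemLpPlus ξ 0 P) :
    ∃ β : ℝ, 0 < β ∧ Integrable (fun ω => halfPlaneCLM p (generator p α (ξ ω)) ^ (-β)) P := by
  obtain ⟨s, hs, hL⟩ := hint
  obtain ⟨κ, r, hκ, hr, hle⟩ := exists_le_halfPlaneCLM_generator h
  have hβ : 0 < s / r := div_pos hs hr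
  have hξc : MemLp (fun ω => (ξ ω : ℂ)) (ENNReal.ofReal s) P := hL.ofReal
  have hsum : MemLp (fun ω => (ξ ω : ℂ) + α) (ENNReal.ofReal s) P :=
    hξc.add (memLp_const α)
  have hi : Integrable (fun ω => ‖(ξ ω : ℂ) + α‖ ^ s) P := by
    have := hsum.integrable_norm_rpow (by simpa using hs) ENNReal.ofReal_ne_top
    rwa [ENNReal.toReal_ofReal hs.le] at this
  have hm : Measurable fun ω => halfPlaneCLM p (generator p α (ξ ω)) :=
    (halfPlaneCLM p).measurable.comp
      (measurable_generator.comp (Complex.measurable_ofReal.comp hξ))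
  -- The exponent `s / r` is the one for which `(‖X + α‖^(-r))^(-β)` is `‖X + α‖^s`.
  refine ⟨s / r, hβ, (hi.const_mul (κ ^ (-(s / r)))).mono'
    (hm.pow_const _).aestronglyMeasurable ?_⟩
  filter_upwards [hξ0] with ω hω
  have hn : 0 < ‖(ξ ω : ℂ) + α‖ := norm_pos_iff.2 hω
  have h1 : 0 < κ * ‖(ξ ω : ℂ) + α‖ ^ (-r) := mul_pos hκ (Real.rpow_pos_of_pos hn _)
  rw [Real.norm_of_nonneg (Real.rpow_nonneg (h1.le.trans (hle _ hω)) _)]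
  refine (Real.rpow_le_rpow_of_nonpos h1 (hle _ hω) (by linarith)).trans_eq ?_
  rw [Real.mul_rpow hκ.le (Real.rpow_nonneg hn.le _), ← Real.rpow_mul hn.le]
  have e : -r * -(s / r) = s := by field_simp
  rw [e]

theorem norm_generator_le (hp : p < 0) (hα : 0 < α.im) (x : ℝ) :
    ‖generator p α x‖ ≤ α.im ^ p := by
  unfold generator
  rw [Complex.norm_cpow_real]
  refine Real.rpow_le_rpow_of_nonpos hα ?_ hp.le
  have := (le_abs_self _).trans (Complex.abs_im_le_norm ((x : ℂ) + α))
  rwa [im_ofReal_add] at this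

theorem exists_isPositiveIID (h : Admissible p α) (hX_meas : ∀ j, Measurable (X j))
    (hX_indep : iIndepFun X P) (hX_ident : ∀ j, IdentDistrib (X j) (X 0) P P)
    (hX_cont : ∀ x : ℝ, P {ω | X 0 ω = x} = 0) (hX_int : MemLpPlus (X 0) 0 P)
    (hint : Integrable (fun ω => generator p α (X 0 ω)) P) :
    ∃ β : ℝ, IsPositiveIID (halfPlaneCLM p) (fun j ω => generator p α (X j ω)) β P := by
  have hm : Measurable fun x : ℝ => generator p α x :=
    measurable_generator.comp Complex.measurable_ofReal
  have hne := ae_ofReal_add_ne_zero (α := α) hX_cont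
  obtain ⟨β, hβ, hi⟩ := exists_integrable_rpow_neg h (hX_meas 0) hne hX_int
  exact ⟨β,
    { measurable := fun j => hm.comp (hX_meas j)
      indep := hX_indep.comp (fun _ x => generator p α x) fun _ => hm
      ident := fun j => (hX_ident j).comp hm
      integrable := hint
      pos := hne.mono fun ω hω => halfPlaneCLM_generator_pos h hω
      pos_β := hβ
      negMoment := hi }⟩

end Sample

end PowerMean

end
-- The limit theorem in the cases of finite and infinite variance
theorem mainTheorem4 {Ω : Type*} [MeasurableSpace Ω] (P : Measure Ω) [IsProbabilityMeasure P]
    (X : ℕ → Ω → ℝ) (hX_meas : ∀ j, Measurable (X j))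
    (hX_indep : iIndepFun X P) (hX_ident : ∀ j, IdentDistrib (X j) (X 0) P P)
    (hX_cont : ∀ x : ℝ, P {ω | X 0 ω = x} = 0)
    (hX_int : PowerMean.MemLpPlus (X 0) 0 P) (p : ℝ) (α : ℂ) :
    (((-1 ≤ p ∧ p < 0 ∧ 0 < α.im) ∨
        (-1 < p ∧ p < 0 ∧ α.im = 0 ∧
          MemLp (fun ω => PowerMean.generator p α (X 0 ω)) 2 P)) →
      MemLp (fun ω => PowerMean.generator p α (X 0 ω)) 2 P ∧
      (∀ᶠ n : ℕ in atTop,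
        MemLp (PowerMean.quasiMean (PowerMean.generator p α) (PowerMean.domain α) X n) 2 P) ∧
      Tendsto
        (fun n : ℕ => (n : ℝ) * PowerMean.complexVar
          (PowerMean.quasiMean (PowerMean.generator p α) (PowerMean.domain α) X n) P)
        atTop
        (𝓝 (PowerMean.asymptoticVar (PowerMean.generator p α) (PowerMean.domain α) (X 0) P))) ∧
    ((-1 < p ∧ p < 0 ∧ α.im = 0 ∧
        MemLp (fun ω => PowerMean.generator p α (X 0 ω)) 1 P ∧
        ¬ MemLp (fun ω => PowerMean.generator p α (X 0 ω)) 2 P) →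
      (∀ᶠ n : ℕ in atTop,
        MemLp (PowerMean.quasiMean (PowerMean.generator p α) (PowerMean.domain α) X n) 2 P) ∧
      Tendsto
        (fun n : ℕ => (n : ℝ) * PowerMean.complexVar
          (PowerMean.quasiMean (PowerMean.generator p α) (PowerMean.domain α) X n) P)
        atTop atTop) := by
  set g : ℂ → ℂ := fun w => w ^ ((p⁻¹ : ℝ) : ℂ) with hg_def
  set Z : ℕ → Ω → ℂ := fun j ω => PowerMean.generator p α (X j ω) with hZ_def
  -- Almost surely the quasi-arithmetic mean is `g (W_n) - α`, and the constant affects neither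
  -- square-integrability nor the variance.
  have transfer : ∀ h : PowerMean.Admissible p α,
      (∀ᶠ n : ℕ in atTop, MemLp (fun ω => g (PowerMean.sampleMean Z n ω)) 2 P) →
      (∀ᶠ n : ℕ in atTop, MemLp
        (PowerMean.quasiMean (PowerMean.generator p α) (PowerMean.domain α) X n) 2 P) ∧
      ∀ᶠ n : ℕ in atTop,
        (n : ℝ) * PowerMean.complexVar (fun ω => g (PowerMean.sampleMean Z n ω)) P =
        (n : ℝ) * PowerMean.complexVar
          (PowerMean.quasiMean (PowerMean.generator p α) (PowerMean.domain α) X n) P := by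
    intro h hL
    constructor
    · filter_upwards [hL, eventually_gt_atTop 0] with n hn hn0
      exact (memLp_congr_ae (PowerMean.quasiMean_ae_eq h hX_ident hX_cont hn0)).2
        (hn.sub (memLp_const α))
    · filter_upwards [hL, eventually_gt_atTop 0] with n hn hn0
      rw [PowerMean.complexVar_congr (PowerMean.quasiMean_ae_eq h hX_ident hX_cont hn0),
        PowerMean.complexVar_sub_const (hn.integrable one_le_two)]
  constructor
  · intro hyp
    have h : PowerMean.Admissible p α := by
      rcases hyp with ⟨h1, h2, h3⟩ | ⟨h1, h2, h3, -⟩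
      · exact ⟨h1, h2, h3.le, Or.inl h3⟩
      · exact ⟨h1.le, h2, h3.ge, Or.inr h1⟩
    have hZm : Measurable (Z 0) := PowerMean.measurable_generator.comp
      (Complex.measurable_ofReal.comp (hX_meas 0))
    have hZ2 : MemLp (Z 0) 2 P := by
      rcases hyp with ⟨h1, h2, h3⟩ | ⟨-, -, -, h4⟩
      · exact MemLp.of_bound hZm.aestronglyMeasurable (α.im ^ p)
          (.of_forall fun ω => PowerMean.norm_generator_le h2 h3 _)
      · exact h4
    have hint : Integrable (Z 0) P := hZ2.integrable one_le_two
    obtain ⟨β, hiid⟩ := PowerMean.exists_isPositiveIID h hX_meas hX_indep hX_ident hX_cont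
      hX_int hint
    have hctl := PowerMean.isControlled_cpow_inv h.neg_one_le h.neg
    obtain ⟨t1, t2⟩ := transfer h (hiid.eventually_memLp hctl)
    refine ⟨hZ2, t1, ?_⟩
    have hlim := hiid.tendsto_nat_mul_complexVar hctl hZ2
    obtain ⟨hpos, hdom, hinv⟩ := PowerMean.generatorInv_integral h
      (PowerMean.ae_ofReal_add_ne_zero hX_cont) hint
    have hw0 : ∫ ω, PowerMean.generator p α (X 0 ω) ∂P ≠ 0 := fun h0 => by
      rw [h0, map_zero] at hpos
      exact hpos.false
    rw [PowerMean.sq_norm_deriv_cpow_inv h hw0 hdom hinv] at hlim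
    exact hlim.congr' t2
  · rintro ⟨h1, h2, h3, hL1, hL2⟩
    have h : PowerMean.Admissible p α := ⟨h1.le, h2, h3.ge, Or.inr h1⟩
    have hint : Integrable (Z 0) P := memLp_one_iff_integrable.1 hL1
    obtain ⟨β, hiid⟩ := PowerMean.exists_isPositiveIID h hX_meas hX_indep hX_ident hX_cont
      hX_int hint
    have hctl := PowerMean.isControlled_cpow_inv h.neg_one_le h.neg
    obtain ⟨t1, t2⟩ := transfer h (hiid.eventually_memLp hctl)
    refine ⟨t1, (hiid.tendsto_nat_mul_complexVar_atTop hctl ?_ hL2).congr' t2⟩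
    have hpos := hiid.integral_pos
    have hw0 : ∫ ω, Z 0 ω ∂P ≠ 0 := fun h0 => by
      rw [h0, map_zero] at hpos
      exact hpos.false
    refine mul_ne_zero ?_ ?_
    · exact_mod_cast inv_ne_zero h.neg.ne
    · rw [Complex.cpow_ne_zero_iff]
      exact Or.inl hw0
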